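/- **Setting.** Fix $r_{\min}>0$. An oriented point is a pair $P=(\mathbf p,\theta)$ of a point $\mathbf p\in\mathbb R^2$ and a heading angle $\theta$. A *curvature-bounded trajectory* of length $s\ge 0$ from $A=(\mathbf a,\alpha)$ to $B=(\mathbf b,\beta)$ is a map $\Lambda:[0,s]\to\mathbb R^2$ that is $C^1$ and piecewise $C^2$, with $|\Lambda'|=1$, $\Lambda(0)=\mathbf a$, $\Lambda(s)=\mathbf b$, $\Lambda'(0)=(\cos\alpha,\sin\alpha)$, $\Lambda'(s)=(\cos\beta,\sin\beta)$ and $\|\Lambda''\|\le 1/r_{\min}$ wherever $\Lambda''$ is defined. Let $l_m$ be the length of a shortest such trajectory $\Lambda_m$ from $A$ to $B$. Let $\mathbf c^l_P$, $\mathbf c^r_P$ be the centres of the circles of radius $r_{\min}$ tangent to $P$ on its left and on its right. Let $L$, $R$ denote a left or right circular arc of radius $r_{\min}$ with central angle in $[0,2\pi)$ and $S$ a straight segment of length $\ge 0$; $C$ stands for $L$ or $R$. In $C_\eta S_dC_\zeta$ the numbers $\eta,\zeta$ are the central angles of the arcs and $d$ is the length of the segment. Let $\mathcal O$ be the set of pairs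 $(A,B)$ for which some shortest trajectory $\Lambda_m$ is of the form $C_\eta S_dC_\zeta$ and at least one of the following holds: $\eta\ge\pi$ (set $\mathcal O_1$), $\zeta\ge\pi$ ($\mathcal O_2$), $d\ge 4r_{\min}$ ($\mathcal O_3$), $|\mathbf c^r_A-\mathbf c^r_B|\ge 4r_{\min}$ ($\mathcal O_4$), $|\mathbf c^l_A-\mathbf c^l_B|\ge4r_{\min}$ ($\mathcal O_5$). Let $\mathcal O^c$ be the set of pairs $(A,B)\notin\mathcal O$ for which some shortest trajectory is of the form $CSC$. For $(A,B)\in\mathcal O^c$ let $l^s_{LRL}\le l^l_{LRL}$ be the lengths of the shorter and of the longer $LRL$ path from $A$ to $B$, let $l^s_{RLR}\le l^l_{RLR}$ be those of the $RLR$ paths, and let $l_{RSR},l_{LSL},l_{RSL},l_{LSR}$ be the lengths of the $CSC$ paths of each type (those that exist). Put $$l_1=\max\{l^s_{LRL},l^s_{RLR}\},\qquad l_2=\min\bigl(\{l_m+2\pi r_{\min},\,l^l_{LRL},\,l^l_{RLR}\}\cup(\{l_{RSR},l_{LSL},l_{RSL},l_{LSR}\}\setminus\{l_m\})\bigr).$$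 A *Circle-Circle-Circle trajectory* $\mathbf C^{r_1}\mathbf C^{r_2}\mathbf C^{r_3}$ is a trajectory that is the concatenation of three successive circular arcs (each possibly of length zero, and at most one full turn) on circles of signed radii $r_1,r_2,r_3$ (counter-clockwise for $r_i>0$, clockwise for $r_i<0$), consecutive circles being tangent at the changeover point; the limit case $|r_2|=\infty$, in which the middle piece is a straight segment, is included. **Theorem.** Let $(A,B)\in\mathcal O^c$. Then for every $l_o\in[l_m,l_1]\cup[l_2,\infty)$ there is a curvature-bounded trajectory of length $l_o$ from $A$ to $B$ that is a Circle-Circle-Circle trajectory $\mathbf C^{r_1}\mathbf C^{r_2}\mathbf C^{r_3}$ with $|r_1|,|r_2|,|r_3|\ge r_{\min}$; in particular it has at most two changeover points. -/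

import Mathlib

open Set

noncomputable section

namespace Dubins

/-! The Euclidean plane is modelled by `ℂ` (with its Euclidean norm). -/

/-- An oriented point: a position in the plane and a heading angle (in radians). -/
structure OrientedPoint where
  pos : ℂ
  heading : ℝ

/-- The unit vector `(cos θ, sin θ)`. -/
def dir (θ : ℝ) : ℂ := ⟨Real.cos θ, Real.sin θ⟩

/-- Two oriented points coincide: same position, same direction (headings modulo `2π`). -/
def SamePose (P Q : OrientedPoint) : Prop :=
  P.pos = Q.pos ∧ dir P.heading = dir Q.heading

/-- Curvature-bounded trajectories from `A` to `B` of length `s`: the function `Λ` on `[0, s]` is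
parametrized by arc length, is `C¹` (with derivative `v`) and piecewise `C²`, has the prescribed
end points and end directions, and satisfies `‖Λ''‖ ≤ 1 / rmin` wherever `Λ''` exists. -/
def IsTrajectory (rmin : ℝ) (A B : OrientedPoint) (s : ℝ) (Λ : ℝ → ℂ) : Prop :=
  0 ≤ s ∧ ∃ v : ℝ → ℂ,
    ContinuousOn v (Icc 0 s) ∧
    (∀ t ∈ Icc 0 s, HasDerivWithinAt Λ (v t) (Icc 0 s) t) ∧
    (∀ t ∈ Icc 0 s, ‖v t‖ = 1) ∧
    Λ 0 = A.pos ∧ Λ s = B.pos ∧ v 0 = dir A.heading ∧ v s = dir B.heading ∧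
    (∃ (n : ℕ) (τ : ℕ → ℝ), Monotone τ ∧ τ 0 = 0 ∧ τ n = s ∧
      ∀ i < n, ContDiffOn ℝ 1 v (Icc (τ i) (τ (i + 1)))) ∧
    (∀ t ∈ Ioo 0 s, ∀ w : ℂ, HasDerivAt v w t → ‖w‖ ≤ 1 / rmin)

/-- The set of lengths of curvature-bounded trajectories from `A` to `B`. -/
def reachableLengths (rmin : ℝ) (A B : OrientedPoint) : Set ℝ :=
  {s | ∃ Λ : ℝ → ℂ, IsTrajectory rmin A B s Λ}

/-- `l_m`, the length of a shortest curvature-bounded trajectory from `A` to `B`. -/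
def minLength (rmin : ℝ) (A B : OrientedPoint) : ℝ := sInf (reachableLengths rmin A B)

/-- The centre of the circle of signed radius `r` that is tangent to the oriented point `P`
(`r > 0`: the circle lies to the left, motion is counter-clockwise; `r < 0`: to the right,
motion is clockwise). -/
def centre (P : OrientedPoint) (r : ℝ) : ℂ := P.pos + (r : ℂ) * Complex.I * dir P.heading

/-- A piece of a concatenated curve: a circular arc of signed radius `r`, or a straight segment
(the limit `|r| → ∞`). -/
inductive Piece where
  | arc (r : ℝ)
  | line

/-- The oriented point reached from `P` after moving a distance `t` along the piece. -/
def Piece.move : Piece → OrientedPoint → ℝ → OrientedPoint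
  | .arc r, P, t =>
      ⟨centre P r - (r : ℂ) * Complex.I * dir (P.heading + t / r), P.heading + t / r⟩
  | .line, P, t => ⟨P.pos + (t : ℂ) * dir P.heading, P.heading⟩

/-- `p` is an allowed piece of length `ℓ`: an arc has a radius of absolute value at least `rmin`
and is at most one full turn of its circle. -/
def Piece.Allowed (rmin : ℝ) : Piece → ℝ → Prop
  | .arc r, ℓ => rmin ≤ |r| ∧ 0 ≤ ℓ ∧ ℓ ≤ 2 * Real.pi * |r|
  | .line, ℓ => 0 ≤ ℓ

/-- The curve that starts at `A` and follows `p₁` for a length `ℓ₁`, then `p₂` for a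
length `ℓ₂`, then `p₃`. Consecutive pieces share position and direction, so consecutive circles are
tangent at the changeover points, which are passed at the times `ℓ₁` and `ℓ₁ + ℓ₂`. -/
def concatCurve (A : OrientedPoint) (p₁ p₂ p₃ : Piece) (ℓ₁ ℓ₂ : ℝ) (t : ℝ) : ℂ :=
  if t ≤ ℓ₁ then (p₁.move A t).pos
  else if t ≤ ℓ₁ + ℓ₂ then (p₂.move (p₁.move A ℓ₁) (t - ℓ₁)).pos
  else (p₃.move (p₂.move (p₁.move A ℓ₁) ℓ₂) (t - ℓ₁ - ℓ₂)).pos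

/-- Circle-Circle-Circle curves of length `l` that start at the oriented point `A`: an arc of
signed radius `r₁`, then an arc of signed radius `r₂` (or a segment, the limit `|r₂| = ∞`), then an
arc of signed radius `r₃`, all radii being at least `rmin` in absolute value. -/
def IsCircleCircleCircle (rmin : ℝ) (A : OrientedPoint) (l : ℝ) (Λ : ℝ → ℂ) : Prop :=
  ∃ (r₁ r₃ : ℝ) (p₂ : Piece) (ℓ₁ ℓ₂ ℓ₃ : ℝ),
    (Piece.arc r₁).Allowed rmin ℓ₁ ∧ p₂.Allowed rmin ℓ₂ ∧ (Piece.arc r₃).Allowed rmin ℓ₃ ∧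
    l = ℓ₁ + ℓ₂ + ℓ₃ ∧
    ∀ t ∈ Icc 0 l, Λ t = concatCurve A (.arc r₁) p₂ (.arc r₃) ℓ₁ ℓ₂ t

/-- Left or right turn. -/
inductive Turn where
  | L
  | R

/-- The opposite turn. -/
def Turn.opp : Turn → Turn
  | .L => .R
  | .R => .L

/-- The signed radius of a turn on a circle of radius `rmin`. -/
def Turn.radius (rmin : ℝ) : Turn → ℝ
  | .L => rmin
  | .R => -rmin

/-- There is a path `X_η S_d Y_ζ` from `A` to `B`, on circles of radius `rmin`; here `η` and `ζ` are
the central angles of the arcs and `d` is the length of the segment. -/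
def IsCSC (rmin : ℝ) (A B : OrientedPoint) (X Y : Turn) (η d ζ : ℝ) : Prop :=
  η ∈ Ico 0 (2 * Real.pi) ∧ 0 ≤ d ∧ ζ ∈ Ico 0 (2 * Real.pi) ∧
    SamePose B ((Piece.arc (Y.radius rmin)).move
      (Piece.line.move ((Piece.arc (X.radius rmin)).move A (rmin * η)) d) (rmin * ζ))

/-- There is a path `X_η X'_μ X_ζ` from `A` to `B`, where `X'` is the turn opposite to `X` (so `LRL`
for `X = L` and `RLR` for `X = R`), on circles of radius `rmin`; here `η`, `μ`, `ζ` are the central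
angles of the arcs. -/
def IsCCC (rmin : ℝ) (A B : OrientedPoint) (X : Turn) (η μ ζ : ℝ) : Prop :=
  η ∈ Ico 0 (2 * Real.pi) ∧ μ ∈ Ico 0 (2 * Real.pi) ∧ ζ ∈ Ico 0 (2 * Real.pi) ∧
    SamePose B ((Piece.arc (X.radius rmin)).move
      ((Piece.arc (X.opp.radius rmin)).move
        ((Piece.arc (X.radius rmin)).move A (rmin * η)) (rmin * μ)) (rmin * ζ))

/-- `Λ_m ∈ C_η S_d C_ζ`: a path `C_η S_d C_ζ` from `A` to `B` is a shortest curvature-bounded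
trajectory. -/
def IsShortestCSC (rmin : ℝ) (A B : OrientedPoint) (η d ζ : ℝ) : Prop :=
  ∃ X Y : Turn, IsCSC rmin A B X Y η d ζ ∧ rmin * η + d + rmin * ζ = minLength rmin A B

def O₁ (rmin : ℝ) : Set (OrientedPoint × OrientedPoint) :=
  {AB | ∃ η d ζ, IsShortestCSC rmin AB.1 AB.2 η d ζ ∧ Real.pi ≤ η}

def O₂ (rmin : ℝ) : Set (OrientedPoint × OrientedPoint) :=
  {AB | ∃ η d ζ, IsShortestCSC rmin AB.1 AB.2 η d ζ ∧ Real.pi ≤ ζ}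

def O₃ (rmin : ℝ) : Set (OrientedPoint × OrientedPoint) :=
  {AB | ∃ η d ζ, IsShortestCSC rmin AB.1 AB.2 η d ζ ∧ 4 * rmin ≤ d}

def O₄ (rmin : ℝ) : Set (OrientedPoint × OrientedPoint) :=
  {AB | ∃ η d ζ, IsShortestCSC rmin AB.1 AB.2 η d ζ ∧
    4 * rmin ≤ dist (centre AB.1 (-rmin)) (centre AB.2 (-rmin))}

def O₅ (rmin : ℝ) : Set (OrientedPoint × OrientedPoint) :=
  {AB | ∃ η d ζ, IsShortestCSC rmin AB.1 AB.2 η d ζ ∧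
    4 * rmin ≤ dist (centre AB.1 rmin) (centre AB.2 rmin)}

def O (rmin : ℝ) : Set (OrientedPoint × OrientedPoint) :=
  O₁ rmin ∪ O₂ rmin ∪ O₃ rmin ∪ O₄ rmin ∪ O₅ rmin

/-- The set `𝒪ᶜ`: the pairs outside `𝒪` for which the Dubins shortest path is of type `CSC`. -/
def Oc (rmin : ℝ) : Set (OrientedPoint × OrientedPoint) :=
  {AB | (∃ η d ζ, IsShortestCSC rmin AB.1 AB.2 η d ζ) ∧ AB ∉ O rmin}

/-- The lengths of the `CSC` paths of type `X S Y` from `A` to `B` (empty if there is none). -/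
def lengthsCSC (rmin : ℝ) (A B : OrientedPoint) (X Y : Turn) : Set ℝ :=
  {l | ∃ η d ζ, IsCSC rmin A B X Y η d ζ ∧ l = rmin * η + d + rmin * ζ}

/-- The lengths of the `CCC` paths from `A` to `B` of type `LRL` (`X = L`) or `RLR` (`X = R`). For a
pair in `𝒪ᶜ` these are the lengths of the two paths of that type. -/
def lengthsCCC (rmin : ℝ) (A B : OrientedPoint) (X : Turn) : Set ℝ :=
  {l | ∃ η μ ζ, IsCCC rmin A B X η μ ζ ∧ l = rmin * (η + μ + ζ)}

/-- The length of the shorter `LRL` (`X = L`) or `RLR` (`X = R`) path. -/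
def shortCCC (rmin : ℝ) (A B : OrientedPoint) (X : Turn) : ℝ := sInf (lengthsCCC rmin A B X)

/-- The length of the longer `LRL` (`X = L`) or `RLR` (`X = R`) path. -/
def longCCC (rmin : ℝ) (A B : OrientedPoint) (X : Turn) : ℝ := sSup (lengthsCCC rmin A B X)

/-- `l₁ = max {l^s_LRL, l^s_RLR}`. -/
def l₁ (rmin : ℝ) (A B : OrientedPoint) : ℝ :=
  max (shortCCC rmin A B .L) (shortCCC rmin A B .R)

/-- `l₂`, the minimum of `l_m + 2π rmin`, `l^l_LRL`, `l^l_RLR` and of the lengths in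
`{l_RSR, l_LSL, l_RSL, l_LSR} \ {l_m}`. -/
def l₂ (rmin : ℝ) (A B : OrientedPoint) : ℝ :=
  sInf ({minLength rmin A B + 2 * Real.pi * rmin, longCCC rmin A B .L, longCCC rmin A B .R} ∪
    ((⋃ (X : Turn) (Y : Turn), lengthsCSC rmin A B X Y) \ {minLength rmin A B}))

end Dubins

end

/-! After scaling to `rmin = 1` and moving to the frame of `A`, only the end position `p` and the
end direction `z` matter. Reflection and reversal reduce the CSC types to LSL and LSR.

The engine is a continuous deformation. The segment is bent into a left arc of half-turning `u` and
half-chord `S`; the end circles stay fixed and the end arcs adapt. The length `a + b + 2 * S / sinc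
u` is continuous, so the intermediate value theorem fills in all lengths. Left end arcs shrink or,
once empty, count as right arcs, and these do not shrink. The bending stops in one of three ways:
`u` tends to `π` and the length is unbounded; an end arc becomes a full turn, whose circle can then
be enlarged freely; or the middle radius falls to one and the curve is an RLR path. The last outcome
needs total turning, an invariant of the bending, below `π`. This dichotomy is `Climb`; it is proved
in `Cfg.climb_right_right`, `Cfg.climb_left_right` and `UnitCSC.climb_left_left`.

Bending the shortest path to one side or to the other reaches every length up to `l₁`. From `l₂` on,
a second path serves whose length can grow without bound. A CCC path whose middle arc is at least a
half turn is handled by `Cfg.conn_of_half_turn`. A CSC path of another length is either an LSL or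
RSR path with turning at least `π`, or it is elongated by enlarging an end circle
(`UnitCSC.conn_of_right_left`). For `l_m + 2π`, a suitable path that is not longer is constructed.
-/

namespace Dubins

/-! ### Three-piece curves are curvature-bounded trajectories -/

/-- The unit complex number with argument `t`. -/
noncomputable def cis (t : ℝ) : ℂ := Complex.exp (t * Complex.I)

lemma cis_re (t : ℝ) : (cis t).re = Real.cos t := by
  simp [cis, Complex.exp_ofReal_mul_I_re]

lemma cis_im (t : ℝ) : (cis t).im = Real.sin t := by
  simp [cis, Complex.exp_ofReal_mul_I_im]

lemma dir_eq_cis (t : ℝ) : dir t = cis t := by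
  apply Complex.ext <;> simp [dir, cis_re, cis_im]

lemma cis_zero : cis 0 = 1 := by simp [cis]

lemma cis_add (s t : ℝ) : cis (s + t) = cis s * cis t := by
  simp [cis, add_mul, Complex.exp_add]

lemma norm_cis (t : ℝ) : ‖cis t‖ = 1 := by
  simp [cis, Complex.norm_exp_ofReal_mul_I]

lemma hasDerivAt_cis (c k t : ℝ) :
    HasDerivAt (fun t : ℝ => cis (c + k * t)) ((k : ℂ) * Complex.I * cis (c + k * t)) t := by
  have h1 : HasDerivAt (fun t : ℝ => (((c + k * t : ℝ) : ℂ) * Complex.I)) ((k : ℂ) * Complex.I) t := by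
    have h := ((hasDerivAt_id t).const_mul k).const_add c
    simpa using h.ofReal_comp.mul_const Complex.I
  have := h1.cexp
  rw [mul_comm] at this
  exact this

lemma contDiff_cis (c k : ℝ) : ContDiff ℝ 1 (fun t : ℝ => cis (c + k * t)) := by
  unfold cis
  apply ContDiff.cexp
  apply ContDiff.mul _ contDiff_const
  exact Complex.ofRealCLM.contDiff.comp (contDiff_const.add (contDiff_const.mul contDiff_id))

/-- The signed curvature of a piece. -/
noncomputable def Piece.curvature : Piece → ℝ
  | .arc r => 1 / r
  | .line => 0

lemma Piece.move_heading (p : Piece) (P : OrientedPoint) (t : ℝ) :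
    (p.move P t).heading = P.heading + p.curvature * t := by
  cases p <;> simp [Piece.move, Piece.curvature, div_eq_inv_mul]

lemma Piece.move_zero (p : Piece) (P : OrientedPoint) : p.move P 0 = P := by
  cases p <;> simp [Piece.move, centre]

lemma Piece.Allowed.nonneg {rmin ℓ : ℝ} {p : Piece} (h : p.Allowed rmin ℓ) : 0 ≤ ℓ := by
  cases p with
  | arc r => exact h.2.1
  | line => exact h

lemma Piece.Allowed.abs_curvature_le {rmin ℓ : ℝ} {p : Piece} (hr : 0 < rmin)
    (h : p.Allowed rmin ℓ) : |p.curvature| ≤ 1 / rmin := by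
  cases p with
  | arc r =>
    simp only [Piece.curvature, abs_div, abs_one]
    exact one_div_le_one_div_of_le hr h.1
  | line => simp [Piece.curvature, hr.le]

lemma Piece.Allowed.hasDerivAt_move {rmin ℓ : ℝ} {p : Piece} (hr : 0 < rmin)
    (h : p.Allowed rmin ℓ) (P : OrientedPoint) (t : ℝ) :
    HasDerivAt (fun t => (p.move P t).pos) (cis (P.heading + p.curvature * t)) t := by
  cases p with
  | arc r =>
    have hr0 : (r : ℂ) ≠ 0 := by
      intro h0
      have h1 := h.1
      rw [Complex.ofReal_eq_zero.1 h0, abs_zero] at h1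
      linarith
    have h1 := (((hasDerivAt_cis P.heading (1 / r) t).const_mul ((r : ℂ) * Complex.I)).const_sub
      (centre P r))
    have h2 : -((r : ℂ) * Complex.I * (((1 / r : ℝ) : ℂ) * Complex.I * cis (P.heading + 1 / r * t)))
        = cis (P.heading + 1 / r * t) := by
      generalize cis (P.heading + 1 / r * t) = Z
      push_cast
      field_simp
      linear_combination (-Z) * Complex.I_sq
    rw [h2] at h1
    refine h1.congr_of_eventuallyEq (Filter.Eventually.of_forall fun s => ?_)
    simp only [Piece.move, dir_eq_cis]
    rw [div_eq_inv_mul, one_div]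
  | line =>
    simp only [Piece.move, Piece.curvature, dir_eq_cis, zero_mul, add_zero]
    have h1 : HasDerivAt (fun t : ℝ => (t : ℂ)) 1 t := by
      simpa using (hasDerivAt_id t).ofReal_comp
    simpa using (h1.mul_const (cis P.heading)).const_add P.pos

lemma hasDerivAt_ite_le {f g f' g' : ℝ → ℂ} {c : ℝ} (hf : ∀ t, HasDerivAt f (f' t) t)
    (hg : ∀ t, HasDerivAt g (g' t) t) (h : f c = g c) (h' : f' c = g' c) (t : ℝ) :
    HasDerivAt (fun t => if t ≤ c then f t else g t) (if t ≤ c then f' t else g' t) t := by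
  rcases lt_trichotomy t c with ht | rfl | ht
  · rw [if_pos ht.le]
    refine (hf t).congr_of_eventuallyEq ?_
    filter_upwards [Iio_mem_nhds ht] with s hs
    rw [if_pos (le_of_lt hs)]
  · rw [if_pos le_rfl, ← hasDerivWithinAt_univ, ← Iic_union_Ici (a := t)]
    refine HasDerivWithinAt.union ?_ ?_
    · refine (hf t).hasDerivWithinAt.congr (fun s hs => if_pos hs) (if_pos le_rfl)
    · rw [h']
      refine (hg t).hasDerivWithinAt.congr (fun s hs => ?_) (by rw [if_pos le_rfl, h])
      rcases (mem_Ici.1 hs).eq_or_lt with rfl | hs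
      · rw [if_pos le_rfl, h]
      · rw [if_neg (not_le.2 hs)]
  · rw [if_neg (not_le.2 ht)]
    refine (hg t).congr_of_eventuallyEq ?_
    filter_upwards [Ioi_mem_nhds ht] with s hs
    rw [if_neg (not_le.2 hs)]

lemma ite_le_eq_of_le {f g : ℝ → ℂ} {c t : ℝ} (h : f c = g c) (ht : c ≤ t) :
    (if t ≤ c then f t else g t) = g t := by
  rcases ht.eq_or_lt with rfl | ht
  · rw [if_pos le_rfl, h]
  · rw [if_neg (not_le.2 ht)]

lemma continuous_ite_le {f g : ℝ → ℂ} {c : ℝ} (hf : Continuous f) (hg : Continuous g)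
    (h : f c = g c) : Continuous (fun t => if t ≤ c then f t else g t) :=
  hf.if_le hg continuous_id continuous_const (by rintro x rfl; exact h)

/-- Only values to the left of `t` are used. So the bound also covers a changeover point where `v`
happens to be differentiable: the derivative there is that of the piece that ends there. -/
lemma norm_le_of_hasDerivAt_of_eqOn_Ioc {v : ℝ → ℂ} {c k a b t : ℝ} {w : ℂ} (ht : t ∈ Ioc a b)
    (hv : ∀ s ∈ Ioc a b, v s = cis (c + k * s)) (hw : HasDerivAt v w t) : ‖w‖ ≤ |k| := by
  have h1 : HasDerivWithinAt v w (Ioc a t) t := hw.hasDerivWithinAt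
  have h2 : HasDerivWithinAt v ((k : ℂ) * Complex.I * cis (c + k * t)) (Ioc a t) t :=
    (hasDerivAt_cis c k t).hasDerivWithinAt.congr
      (fun s hs => hv s ⟨hs.1, hs.2.trans ht.2⟩) (hv t ht)
  have h3 : UniqueDiffWithinAt ℝ (Ioc a t) t :=
    uniqueDiffOn_Ioc a t t ⟨ht.1, le_rfl⟩
  rw [h3.eq_deriv _ h1 h2]
  simp [norm_cis]

/-- Three allowed pieces that lead from `A` to `B` form a curvature-bounded trajectory. -/
theorem isTrajectory_concatCurve {rmin : ℝ} (hr : 0 < rmin) {A B : OrientedPoint}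
    {p₁ p₂ p₃ : Piece} {ℓ₁ ℓ₂ ℓ₃ : ℝ} (h₁ : p₁.Allowed rmin ℓ₁) (h₂ : p₂.Allowed rmin ℓ₂)
    (h₃ : p₃.Allowed rmin ℓ₃)
    (hB : SamePose B (p₃.move (p₂.move (p₁.move A ℓ₁) ℓ₂) ℓ₃)) :
    IsTrajectory rmin A B (ℓ₁ + ℓ₂ + ℓ₃) (concatCurve A p₁ p₂ p₃ ℓ₁ ℓ₂) := by
  have n₁ := h₁.nonneg
  have n₂ := h₂.nonneg
  have n₃ := h₃.nonneg
  set P₁ := p₁.move A ℓ₁ with hP₁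
  set P₂ := p₂.move P₁ ℓ₂ with hP₂
  have e₁ : P₁.heading = A.heading + p₁.curvature * ℓ₁ := p₁.move_heading A ℓ₁
  have e₂ : P₂.heading = P₁.heading + p₂.curvature * ℓ₂ := p₂.move_heading P₁ ℓ₂
  obtain ⟨c₂, hc₂⟩ : ∃ c, c = P₁.heading - p₂.curvature * ℓ₁ := ⟨_, rfl⟩
  obtain ⟨c₃, hc₃⟩ : ∃ c, c = P₂.heading - p₃.curvature * (ℓ₁ + ℓ₂) := ⟨_, rfl⟩
  let f₁ : ℝ → ℂ := fun t => (p₁.move A t).pos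
  let f₂ : ℝ → ℂ := fun t => (p₂.move P₁ (t - ℓ₁)).pos
  let f₃ : ℝ → ℂ := fun t => (p₃.move P₂ (t - ℓ₁ - ℓ₂)).pos
  let v₁ : ℝ → ℂ := fun t => cis (A.heading + p₁.curvature * t)
  let v₂ : ℝ → ℂ := fun t => cis (c₂ + p₂.curvature * t)
  let v₃ : ℝ → ℂ := fun t => cis (c₃ + p₃.curvature * t)
  have d₁ : ∀ t, HasDerivAt f₁ (v₁ t) t := fun t => h₁.hasDerivAt_move hr A t
  have d₂ : ∀ t, HasDerivAt f₂ (v₂ t) t := fun t => by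
    have := (h₂.hasDerivAt_move hr P₁ (t - ℓ₁)).comp_sub_const t ℓ₁
    have e : c₂ + p₂.curvature * t = P₁.heading + p₂.curvature * (t - ℓ₁) := by rw [hc₂]; ring
    simpa only [v₂, e] using this
  have d₃ : ∀ t, HasDerivAt f₃ (v₃ t) t := fun t => by
    have := (h₃.hasDerivAt_move hr P₂ (t - (ℓ₁ + ℓ₂))).comp_sub_const t (ℓ₁ + ℓ₂)
    have e : c₃ + p₃.curvature * t = P₂.heading + p₃.curvature * (t - (ℓ₁ + ℓ₂)) := by
      rw [hc₃]; ring
    simp only [v₃, f₃, e, sub_sub]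
    exact this
  have g₁₂ : f₁ ℓ₁ = f₂ ℓ₁ := by simp [f₁, f₂, Piece.move_zero, hP₁]
  have g₂₃ : f₂ (ℓ₁ + ℓ₂) = f₃ (ℓ₁ + ℓ₂) := by simp [f₂, f₃, Piece.move_zero, hP₂]
  have k₁₂ : v₁ ℓ₁ = v₂ ℓ₁ := by
    simp only [v₁, v₂]; congr 1; rw [hc₂, e₁]; ring
  have k₂₃ : v₂ (ℓ₁ + ℓ₂) = v₃ (ℓ₁ + ℓ₂) := by
    simp only [v₂, v₃]; congr 1; rw [hc₃, hc₂, e₂]; ring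
  have hle : ℓ₁ ≤ ℓ₁ + ℓ₂ := by linarith
  let F : ℝ → ℂ := fun t => if t ≤ ℓ₁ + ℓ₂ then f₂ t else f₃ t
  let V : ℝ → ℂ := fun t => if t ≤ ℓ₁ + ℓ₂ then v₂ t else v₃ t
  let v : ℝ → ℂ := fun t => if t ≤ ℓ₁ then v₁ t else V t
  have dF : ∀ t, HasDerivAt F (V t) t := hasDerivAt_ite_le d₂ d₃ g₂₃ k₂₃
  have gF : f₁ ℓ₁ = F ℓ₁ := by simp only [F, if_pos hle, g₁₂]
  have kV : v₁ ℓ₁ = V ℓ₁ := by simp only [V, if_pos hle, k₁₂]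
  have dΛ : ∀ t, HasDerivAt (concatCurve A p₁ p₂ p₃ ℓ₁ ℓ₂) (v t) t :=
    hasDerivAt_ite_le d₁ dF gF kV
  have cv : Continuous v := by
    refine continuous_ite_le (contDiff_cis _ _).continuous (continuous_ite_le ?_ ?_ k₂₃) kV
    · exact (contDiff_cis _ _).continuous
    · exact (contDiff_cis _ _).continuous
  have v2 : ∀ t, ℓ₁ ≤ t → t ≤ ℓ₁ + ℓ₂ → v t = v₂ t := fun t h h' => by
    simp only [v, ite_le_eq_of_le kV h]
    simp only [V, if_pos h']
  have v3 : ∀ t, ℓ₁ + ℓ₂ ≤ t → v t = v₃ t := fun t h => by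
    simp only [v, ite_le_eq_of_le kV (hle.trans h)]
    simp only [V, ite_le_eq_of_le k₂₃ h]
  refine ⟨by linarith, v, cv.continuousOn, fun t _ => (dΛ t).hasDerivWithinAt, ?_, ?_, ?_, ?_, ?_,
    ?_, ?_⟩
  · intro t _
    simp only [v, V, v₁, v₂, v₃]
    split_ifs <;> exact norm_cis _
  · simp [concatCurve, n₁, Piece.move_zero]
  · have : concatCurve A p₁ p₂ p₃ ℓ₁ ℓ₂ (ℓ₁ + ℓ₂ + ℓ₃) = f₃ (ℓ₁ + ℓ₂ + ℓ₃) := by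
      refine (ite_le_eq_of_le gF (by linarith)).trans (ite_le_eq_of_le g₂₃ (by linarith))
    rw [this, hB.1]
    simp only [f₃]
    congr 2
    ring
  · simp [v, n₁, v₁, dir_eq_cis]
  · rw [v3 _ (by linarith), hB.2, dir_eq_cis, Piece.move_heading]
    simp only [v₃]; congr 1; rw [hc₃]; ring
  · refine ⟨3, fun i => if i = 0 then 0 else if i = 1 then ℓ₁ else if i = 2 then ℓ₁ + ℓ₂ else
      ℓ₁ + ℓ₂ + ℓ₃, ?_, by simp, by simp, ?_⟩
    · refine monotone_nat_of_le_succ fun i => ?_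
      rcases i with _ | _ | _ | i <;> simp <;> linarith
    · intro i hi
      interval_cases i
      · refine (contDiff_cis A.heading p₁.curvature).contDiffOn.congr fun t ht => ?_
        simp only [zero_add, if_true, one_ne_zero, if_false] at ht
        simp only [v, if_pos ht.2, v₁]
      · refine (contDiff_cis c₂ p₂.curvature).contDiffOn.congr fun t ht => ?_
        simp at ht
        exact v2 t ht.1 ht.2
      · refine (contDiff_cis c₃ p₃.curvature).contDiffOn.congr fun t ht => ?_
        simp at ht
        exact v3 t ht.1
  · intro t ht w hw
    rcases le_or_gt t ℓ₁ with h | h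
    · exact (norm_le_of_hasDerivAt_of_eqOn_Ioc (c := A.heading) (a := 0) (b := ℓ₁) ⟨ht.1, h⟩
        (fun s hs => if_pos hs.2) hw).trans (h₁.abs_curvature_le hr)
    rcases le_or_gt t (ℓ₁ + ℓ₂) with h' | h'
    · exact (norm_le_of_hasDerivAt_of_eqOn_Ioc (a := ℓ₁) (b := ℓ₁ + ℓ₂) ⟨h, h'⟩
        (fun s hs => v2 s hs.1.le hs.2) hw).trans (h₂.abs_curvature_le hr)
    · exact (norm_le_of_hasDerivAt_of_eqOn_Ioc (a := ℓ₁ + ℓ₂) (b := t) ⟨h', le_rfl⟩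
        (fun s hs => v3 s hs.1.le) hw).trans (h₃.abs_curvature_le hr)

/-! ### The problem at unit scale and its symmetries -/

open Complex (I I_sq)
open scoped ComplexConjugate

lemma conj_cis (t : ℝ) : conj (cis t) = cis (-t) := by
  apply Complex.ext <;> simp [cis_re, cis_im]

lemma cis_mul_cis_neg (t : ℝ) : cis t * cis (-t) = 1 := by
  rw [← cis_add, add_neg_cancel, cis_zero]

lemma cis_ne_zero (t : ℝ) : cis t ≠ 0 := by
  intro h
  simpa [h] using cis_mul_cis_neg t

lemma cis_add_two_pi (t : ℝ) : cis (t + 2 * Real.pi) = cis t := by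
  apply Complex.ext <;> simp [cis_re, cis_im]

lemma cis_sub_two_pi (t : ℝ) : cis (t - 2 * Real.pi) = cis t := by
  rw [← cis_add_two_pi (t - 2 * Real.pi), sub_add_cancel]

lemma cis_two_pi : cis (2 * Real.pi) = 1 := by
  simpa [cis_zero] using cis_add_two_pi 0

lemma cis_eq_cos_add (t : ℝ) : cis t = (Real.cos t : ℂ) + (Real.sin t : ℂ) * I := by
  apply Complex.ext <;> simp [cis_re, cis_im, -Complex.ofReal_cos, -Complex.ofReal_sin]

lemma cis_eq_cis_iff {s t : ℝ} : cis s = cis t ↔ ∃ n : ℤ, s = t + n * (2 * Real.pi) := by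
  unfold cis
  rw [Complex.exp_eq_exp_iff_exists_int]
  constructor
  · rintro ⟨n, h⟩
    refine ⟨n, ?_⟩
    have h2 := congrArg Complex.im h
    simpa using h2
  · rintro ⟨n, rfl⟩
    refine ⟨n, ?_⟩
    push_cast
    ring

lemma eq_of_cis_eq {s t : ℝ} (h : cis s = cis t) (h' : |s - t| < 2 * Real.pi) : s = t := by
  obtain ⟨n, hn⟩ := cis_eq_cis_iff.1 h
  have hpi := Real.pi_pos
  have h1 : s - t = n * (2 * Real.pi) := by linarith
  rw [h1, abs_mul, abs_of_pos (by positivity : 0 < 2 * Real.pi)] at h'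
  have h2 : |(n : ℝ)| < 1 := by
    by_contra hc
    push Not at hc
    nlinarith
  have h3 : n = 0 := by
    rw [← Int.cast_abs] at h2
    have : |n| < 1 := by exact_mod_cast h2
    exact Int.abs_lt_one_iff.1 this
  subst h3
  simpa using hn

/-- A piece with turning angle `m`, chord `q` (in the frame of its initial direction) and length
`ℓ`: a segment, or an arc of radius at least one. -/
def Mid (m : ℝ) (q : ℂ) (ℓ : ℝ) : Prop :=
  (m = 0 ∧ 0 ≤ ℓ ∧ q = ℓ) ∨
    ∃ r : ℝ, 1 ≤ |r| ∧ 0 ≤ r * m ∧ |m| ≤ 2 * Real.pi ∧ q = -I * r * (cis m - 1) ∧ ℓ = r * m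

/-- There is a Circle-Circle-Circle curve with minimal radius one and length `l` that starts at the
origin in the direction `1` and ends at `p` in the direction `z`. -/
def Conn (p z : ℂ) (l : ℝ) : Prop :=
  ∃ (r₁ x₁ r₃ x₃ m : ℝ) (q : ℂ) (ℓ : ℝ),
    1 ≤ |r₁| ∧ 0 ≤ r₁ * x₁ ∧ |x₁| ≤ 2 * Real.pi ∧
    1 ≤ |r₃| ∧ 0 ≤ r₃ * x₃ ∧ |x₃| ≤ 2 * Real.pi ∧
    Mid m q ℓ ∧ z = cis (x₁ + m + x₃) ∧
    p = -I * r₁ * (cis x₁ - 1) + cis x₁ * q - I * r₃ * (z - cis (x₁ + m)) ∧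
    l = r₁ * x₁ + ℓ + r₃ * x₃

lemma Mid.conj {m : ℝ} {q : ℂ} {ℓ : ℝ} (h : Mid m q ℓ) : Mid (-m) (conj q) ℓ := by
  rcases h with ⟨rfl, h, rfl⟩ | ⟨r, h1, h2, h3, rfl, rfl⟩
  · exact .inl ⟨by simp, h, by simp⟩
  · exact .inr ⟨-r, by simpa, by simpa, by simpa, by simp [conj_cis], by ring⟩

/-- An arc is symmetric about the perpendicular bisector of its chord, so reversing and reflecting
it gives the same arc. -/
lemma Mid.conj_mul_cis {m : ℝ} {q : ℂ} {ℓ : ℝ} (h : Mid m q ℓ) : conj q * cis m = q := by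
  rcases h with ⟨rfl, h, rfl⟩ | ⟨r, h1, h2, h3, rfl, rfl⟩
  · simp [cis_zero]
  · simp only [map_mul, map_sub, map_neg, Complex.conj_I, Complex.conj_ofReal, conj_cis, map_one]
    linear_combination (I * r) * cis_mul_cis_neg m

/-- Reflection in the initial direction. -/
lemma Conn.mirror {p z : ℂ} {l : ℝ} (h : Conn p z l) : Conn (conj p) (conj z) l := by
  obtain ⟨r₁, x₁, r₃, x₃, m, q, ℓ, h1, h2, h3, h4, h5, h6, h7, rfl, rfl, rfl⟩ := h
  refine ⟨-r₁, -x₁, -r₃, -x₃, -m, conj q, ℓ, by simpa, by simpa, by simpa, by simpa, by simpa,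
    by simpa, h7.conj, ?_, ?_, by ring⟩
  · rw [conj_cis]; congr 1; ring
  · simp only [map_mul, map_sub, map_add, map_neg, Complex.conj_I, Complex.conj_ofReal, conj_cis,
      map_one]
    rw [show -(x₁ + m) = -x₁ + -m by ring]
    push_cast
    ring

/-- Reversal of the curve, followed by a reflection: the first and the third piece are swapped. -/
lemma Conn.flip {p z : ℂ} {l : ℝ} (h : Conn p z l) : Conn (conj p * z) z l := by
  obtain ⟨r₁, x₁, r₃, x₃, m, q, ℓ, h1, h2, h3, h4, h5, h6, h7, rfl, rfl, rfl⟩ := h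
  refine ⟨r₃, x₃, r₁, x₁, m, q, ℓ, h4, h5, h6, h1, h2, h3, h7, ?_, ?_, by ring⟩
  · congr 1; ring
  · simp only [map_mul, map_sub, map_add, map_neg, Complex.conj_I, Complex.conj_ofReal, conj_cis,
      map_one, cis_add]
    have e1 := cis_mul_cis_neg x₁
    have e2 := cis_mul_cis_neg m
    have e3 := cis_mul_cis_neg x₃
    have e4 := h7.conj_mul_cis
    generalize conj q = q' at *
    generalize cis x₁ = X at *
    generalize cis (-x₁) = X' at *
    generalize cis m = M at *
    generalize cis (-m) = M' at *
    generalize cis x₃ = Y at *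
    generalize cis (-x₃) = Y' at *
    linear_combination (q' * M * Y + I * r₁ * M * Y + I * r₃ * (Y' - 1) * Y * M * M') * e1 +
      Y * e4 + I * r₃ * (Y' - 1) * Y * e2 + I * r₃ * e3

/-! ### Configurations with a bent middle piece -/

/-- An arc of radius one (signed radius `σ₁`) with turning angle `a`, a left arc with chord `2 * S`
and turning angle `2 * u` (a segment if `u = 0`), and an arc of radius one (signed radius `σ₃`) with
turning angle `b` lead from the origin with direction `1` to `p` with direction `z`. -/
def Cfg (σ₁ σ₃ a u S b : ℝ) (p z : ℂ) : Prop :=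
  z = cis (σ₁ * a + 2 * u + σ₃ * b) ∧
    p = -I * σ₁ * (cis (σ₁ * a) - 1) + 2 * S * cis (σ₁ * a + u) -
      I * σ₃ * (z - cis (σ₁ * a + 2 * u))

lemma cis_sub_cis_neg (u : ℝ) : cis u - cis (-u) = 2 * I * Real.sin u := by
  rw [cis_eq_cos_add, cis_eq_cos_add]
  simp only [Real.cos_neg, Real.sin_neg]
  push_cast
  ring

lemma cis_add_cis_neg (u : ℝ) : cis u + cis (-u) = 2 * Real.cos u := by
  rw [cis_eq_cos_add, cis_eq_cos_add]
  simp only [Real.cos_neg, Real.sin_neg]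
  push_cast
  ring

lemma sinc_pos {u : ℝ} (h0 : 0 ≤ u) (hu : u < Real.pi) : 0 < Real.sinc u := by
  rcases h0.eq_or_lt with rfl | h0
  · simp
  · rw [Real.sinc_of_ne_zero h0.ne']
    exact div_pos (Real.sin_pos_of_pos_of_lt_pi h0 hu) h0

/-- The radius is `S / sin u`, so `sin u ≤ S` is the curvature bound. With `sinc`, segments (`u =
0`) and arcs share one length formula, continuous in `u`. -/
lemma mid_of_chord {u S : ℝ} (h0 : 0 ≤ u) (hu : u < Real.pi) (hS : Real.sin u ≤ S) :
    Mid (2 * u) (2 * S * cis u) (2 * S * (Real.sinc u)⁻¹) := by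
  rcases h0.eq_or_lt with rfl | h0
  · refine .inl ⟨by simp, ?_, by simp [cis_zero]⟩
    simp at hS ⊢
    exact hS
  · have hs := Real.sin_pos_of_pos_of_lt_pi h0 hu
    have hs' : (Real.sin u : ℂ) ≠ 0 := by exact_mod_cast hs.ne'
    refine .inr ⟨S / Real.sin u, ?_, ?_, ?_, ?_, ?_⟩
    · rw [abs_of_nonneg (div_nonneg (hs.le.trans hS) hs.le)]
      exact (one_le_div hs).2 hS
    · have := hs.le.trans hS
      positivity
    · rw [abs_of_pos (by linarith)]; linarith
    · have e : cis (2 * u) - 1 = cis u * (cis u - cis (-u)) := by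
        rw [two_mul, cis_add, mul_sub, cis_mul_cis_neg]
      rw [e, cis_sub_cis_neg]
      push_cast
      rw [Complex.ofReal_sin] at hs'
      field_simp
      linear_combination (S * cis u) * I_sq
    · rw [Real.sinc_of_ne_zero h0.ne']
      field_simp

lemma Cfg.conn {σ₁ σ₃ a u S b : ℝ} {p z : ℂ} (h : Cfg σ₁ σ₃ a u S b p z) (h₁ : |σ₁| = 1)
    (h₃ : |σ₃| = 1) (ha : 0 ≤ a) (ha' : a ≤ 2 * Real.pi) (hb : 0 ≤ b) (hb' : b ≤ 2 * Real.pi)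
    (hu : 0 ≤ u) (hu' : u < Real.pi) (hS : Real.sin u ≤ S) :
    Conn p z (a + b + 2 * S * (Real.sinc u)⁻¹) := by
  obtain ⟨hz, hp⟩ := h
  have s1 : σ₁ * σ₁ = 1 := by rw [← abs_mul_abs_self, h₁, one_mul]
  have s3 : σ₃ * σ₃ = 1 := by rw [← abs_mul_abs_self, h₃, one_mul]
  refine ⟨σ₁, σ₁ * a, σ₃, σ₃ * b, 2 * u, 2 * S * cis u, 2 * S * (Real.sinc u)⁻¹, h₁.ge, ?_, ?_,
    h₃.ge, ?_, ?_, mid_of_chord hu hu' hS, hz, ?_, ?_⟩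
  · rw [← mul_assoc, s1, one_mul]; exact ha
  · rw [abs_mul, h₁, one_mul, abs_of_nonneg ha]; exact ha'
  · rw [← mul_assoc, s3, one_mul]; exact hb
  · rw [abs_mul, h₃, one_mul, abs_of_nonneg hb]; exact hb'
  · rw [hp, cis_add (σ₁ * a) u]; ring
  · rw [← mul_assoc, ← mul_assoc, s1, s3]; ring

lemma Cfg.flip {σ₁ σ₃ a u S b : ℝ} {p z : ℂ} (h : Cfg σ₁ σ₃ a u S b p z) :
    Cfg σ₃ σ₁ b u S a (conj p * z) z := by
  obtain ⟨rfl, rfl⟩ := h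
  refine ⟨by congr 1; ring, ?_⟩
  simp only [map_mul, map_sub, map_add, map_neg, Complex.conj_I, Complex.conj_ofReal, conj_cis,
      map_one, two_mul, cis_add]
  have e1 := cis_mul_cis_neg (σ₁ * a)
  have e2 := cis_mul_cis_neg u
  have e3 := cis_mul_cis_neg (σ₃ * b)
  generalize cis (σ₁ * a) = X at *
  generalize cis (-(σ₁ * a)) = X' at *
  generalize cis u = M at *
  generalize cis (-u) = M' at *
  generalize cis (σ₃ * b) = Y at *
  generalize cis (-(σ₃ * b)) = Y' at *
  have e2' : M ^ 2 * M' ^ 2 = 1 := by rw [← mul_pow, e2, one_pow]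
  linear_combination (I * σ₁ * M ^ 2 * Y + 2 * S * M ^ 2 * M' * Y +
    I * σ₃ * (Y' - 1) * Y * M ^ 2 * M' ^ 2) * e1 + 2 * S * M * Y * e2 +
    I * σ₃ * (Y' - 1) * Y * e2' + I * σ₃ * e3

/-- A full turn on the first circle may be enlarged. -/
lemma conn_of_loop_first {p z : ℂ} {r₃ x₃ m : ℝ} {q : ℂ} {ℓ l : ℝ} (h₃ : 1 ≤ |r₃|)
    (hx : 0 ≤ r₃ * x₃) (hx' : |x₃| ≤ 2 * Real.pi) (hm : Mid m q ℓ) (hz : z = cis (m + x₃))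
    (hp : p = q - I * r₃ * (z - cis m)) (hl : 2 * Real.pi + ℓ + r₃ * x₃ ≤ l) : Conn p z l := by
  have hpi := Real.pi_pos
  -- A full turn of radius `ρ` changes neither position nor direction; `ρ` is chosen to absorb the
  -- missing length.
  obtain ⟨ρ, hρ⟩ : ∃ ρ, ρ = (l - ℓ - r₃ * x₃) / (2 * Real.pi) := ⟨_, rfl⟩
  have hρ1 : 1 ≤ ρ := by rw [hρ, one_le_div (by positivity)]; linarith
  refine ⟨ρ, 2 * Real.pi, r₃, x₃, m, q, ℓ, hρ1.trans (le_abs_self _), by positivity, ?_, h₃, hx, hx',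
    hm, ?_, ?_, ?_⟩
  · rw [abs_of_pos (by positivity)]
  · rw [hz, show 2 * Real.pi + m + x₃ = m + x₃ + 2 * Real.pi by ring, cis_add_two_pi]
  · rw [hp, show 2 * Real.pi + m = m + 2 * Real.pi by ring, cis_add_two_pi, cis_two_pi]; ring
  · rw [hρ]; field_simp; ring

lemma conj_conj_mul_mul {p z : ℂ} (hz : ‖z‖ = 1) : conj (conj p * z) * z = p := by
  rw [map_mul, Complex.conj_conj, mul_assoc, mul_comm (conj z), Complex.mul_conj,
    Complex.normSq_eq_norm_sq, hz]
  simp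

lemma Cfg.norm_eq_one {σ₁ σ₃ a u S b : ℝ} {p z : ℂ} (h : Cfg σ₁ σ₃ a u S b p z) : ‖z‖ = 1 := by
  rw [h.1, norm_cis]

lemma Conn.of_flip {p z : ℂ} {l : ℝ} (hz : ‖z‖ = 1) (h : Conn (conj p * z) z l) : Conn p z l := by
  have h' := h.flip
  rwa [conj_conj_mul_mul hz] at h'

lemma Conn.of_mirror {p z : ℂ} {l : ℝ} (h : Conn (conj p) (conj z) l) : Conn p z l := by
  simpa using h.mirror

lemma Cfg.conn_of_loop_first {σ₁ σ₃ u S b l : ℝ} {p z : ℂ} (h₁ : |σ₁| = 1)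
    (h : Cfg σ₁ σ₃ (2 * Real.pi) u S b p z) (h₃ : |σ₃| = 1) (hb : 0 ≤ b) (hb' : b ≤ 2 * Real.pi)
    (hu : 0 ≤ u) (hu' : u < Real.pi) (hS : Real.sin u ≤ S)
    (hl : 2 * Real.pi + b + 2 * S * (Real.sinc u)⁻¹ ≤ l) : Conn p z l := by
  have s3 : σ₃ * σ₃ = 1 := by rw [← abs_mul_abs_self, h₃, one_mul]
  have hc : ∀ t, cis (σ₁ * (2 * Real.pi) + t) = cis t := by
    intro t
    rcases eq_or_eq_neg_of_abs_eq h₁ with rfl | rfl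
    · rw [one_mul, add_comm, cis_add_two_pi]
    · rw [neg_one_mul, add_comm, ← sub_eq_add_neg, cis_sub_two_pi]
  have hc0 : cis (σ₁ * (2 * Real.pi)) = 1 := by simpa [cis_zero] using hc 0
  obtain ⟨hz, hp⟩ := h
  refine Dubins.conn_of_loop_first (r₃ := σ₃) (x₃ := σ₃ * b) h₃.ge ?_ ?_ (mid_of_chord hu hu' hS) ?_
    ?_ ?_
  · rw [← mul_assoc, s3, one_mul]; exact hb
  · rw [abs_mul, h₃, one_mul, abs_of_nonneg hb]; exact hb'
  · rw [hz, add_assoc, hc]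
  · rw [hp, hc, hc, hc0]; ring
  · rw [← mul_assoc, s3, one_mul]; linarith

lemma Cfg.conn_of_loop_last {σ₁ σ₃ u S a l : ℝ} {p z : ℂ} (h₃ : |σ₃| = 1)
    (h : Cfg σ₁ σ₃ a u S (2 * Real.pi) p z) (h₁ : |σ₁| = 1) (ha : 0 ≤ a) (ha' : a ≤ 2 * Real.pi)
    (hu : 0 ≤ u) (hu' : u < Real.pi) (hS : Real.sin u ≤ S)
    (hl : 2 * Real.pi + a + 2 * S * (Real.sinc u)⁻¹ ≤ l) : Conn p z l :=
  Conn.of_flip h.norm_eq_one (h.flip.conn_of_loop_first h₃ h₁ ha ha' hu hu' hS hl)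

lemma conn_of_intermediate {p z : ℂ} {f : ℝ → ℝ} {x₀ x₁ : ℝ} (h : x₀ ≤ x₁)
    (hf : ContinuousOn f (Icc x₀ x₁)) (hc : ∀ x ∈ Icc x₀ x₁, Conn p z (f x)) :
    ∀ l ∈ Icc (f x₀) (f x₁), Conn p z l := by
  intro l hl
  obtain ⟨x, hx, rfl⟩ := intermediate_value_Icc h hf hl
  exact hc x hx

lemma conn_of_unbounded {p z : ℂ} {f : ℝ → ℝ} {s : Set ℝ} [s.OrdConnected] {x₀ : ℝ} (h₀ : x₀ ∈ s)
    (hf : ContinuousOn f s) (hu : ∀ M, ∃ x ∈ s, M ≤ f x) (hc : ∀ x ∈ s, Conn p z (f x)) :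
    ∀ l, f x₀ ≤ l → Conn p z l := by
  intro l hl
  obtain ⟨x, hx, hM⟩ := hu l
  obtain ⟨y, hy, rfl⟩ := (‹s.OrdConnected›).isPreconnected.intermediate_value h₀ hx hf
    ⟨hl, hM⟩
  exact hc y hy

/-- The source of unbounded lengths: the middle arc approaches a full turn over a chord that does
not shrink to zero. -/
lemma exists_le_inv_sinc (M : ℝ) {u₀ : ℝ} (h0 : 0 ≤ u₀) (hu : u₀ < Real.pi) :
    ∃ u ∈ Ico u₀ Real.pi, M ≤ (Real.sinc u)⁻¹ := by
  have h1 : Filter.Tendsto Real.sinc (nhdsWithin Real.pi (Iio Real.pi)) (nhds 0) := by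
    have h := Real.continuous_sinc.tendsto Real.pi
    rw [Real.sinc_of_ne_zero Real.pi_ne_zero, Real.sin_pi, zero_div] at h
    exact h.mono_left nhdsWithin_le_nhds
  have hM : 0 < (max M 1)⁻¹ := by positivity
  obtain ⟨u, hu1, hu2, hu3⟩ := ((h1.eventually (Iio_mem_nhds hM)).and
    ((Ioo_mem_nhdsLT hu : _ ∈ nhdsWithin Real.pi (Iio Real.pi)))).exists
  refine ⟨u, ⟨hu2.le, hu3⟩, (le_max_left M 1).trans ?_⟩
  have hs := sinc_pos (h0.trans hu2.le) hu3
  exact (le_inv_comm₀ (by positivity) hs).2 (le_of_lt hu1)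

lemma continuousOn_inv_sinc {s : Set ℝ} (hs : ∀ u ∈ s, 0 ≤ u ∧ u < Real.pi) :
    ContinuousOn (fun u => (Real.sinc u)⁻¹) s :=
  Real.continuous_sinc.continuousOn.inv₀ fun u hu => (sinc_pos (hs u hu).1 (hs u hu).2).ne'

/-- A path of three arcs of radius one with alternating orientations, the first one with
orientation `σ`, and turning angles `a`, `μ`, `b`. -/
def UnitCCC (σ a μ b : ℝ) (p z : ℂ) : Prop :=
  0 ≤ a ∧ a < 2 * Real.pi ∧ 0 ≤ μ ∧ μ < 2 * Real.pi ∧ 0 ≤ b ∧ b < 2 * Real.pi ∧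
    z = cis (σ * (a - μ + b)) ∧
    p = -I * σ * (cis (σ * a) - 1) + I * σ * (cis (σ * (a - μ)) - cis (σ * a)) -
      I * σ * (z - cis (σ * (a - μ)))

/-- A path of two arcs of radius one, with orientations `σ₁` and `σ₃` and turning angles `η` and
`ζ`, that are joined by a segment of length `d`. -/
def UnitCSC (σ₁ σ₃ η d ζ : ℝ) (p z : ℂ) : Prop :=
  0 ≤ η ∧ η < 2 * Real.pi ∧ 0 ≤ d ∧ 0 ≤ ζ ∧ ζ < 2 * Real.pi ∧ Cfg σ₁ σ₃ η 0 (d / 2) ζ p z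

/-- Half-chord `sin u` means that the middle arc has radius one. -/
lemma Cfg.unitCCC {a u b : ℝ} {p z : ℂ} (h : Cfg (-1) (-1) a u (Real.sin u) b p z) (ha : 0 ≤ a)
    (ha' : a < 2 * Real.pi) (hb : 0 ≤ b) (hb' : b < 2 * Real.pi) (hu : 0 ≤ u) (hu' : u < Real.pi) :
    UnitCCC (-1) a (2 * u) b p z := by
  refine ⟨ha, ha', by linarith, by linarith, hb, hb', ?_, ?_⟩
  · rw [h.1]; congr 1; ring
  · have e : (2 * (Real.sin u : ℂ)) * cis (-1 * a + u) = -I * (cis (-1 * (a - 2 * u)) - cis (-1 * a)) := by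
      have h1 := cis_sub_cis_neg u
      have h2 := cis_mul_cis_neg u
      rw [show -1 * (a - 2 * u) = -1 * a + (u + u) by ring, cis_add, cis_add, cis_add]
      generalize cis u = U at *
      generalize cis (-u) = U' at *
      linear_combination I * cis (-1 * a) * U * h1 + I * cis (-1 * a) * h2 +
        2 * Real.sin u * cis (-1 * a) * U * I_sq
    rw [h.2, e, show -1 * a + 2 * u = -1 * (a - 2 * u) by ring]
    push_cast
    ring

lemma UnitCCC.mirror {σ a μ b : ℝ} {p z : ℂ} (h : UnitCCC σ a μ b p z) :
    UnitCCC (-σ) a μ b (conj p) (conj z) := by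
  obtain ⟨h1, h2, h3, h4, h5, h6, rfl, rfl⟩ := h
  refine ⟨h1, h2, h3, h4, h5, h6, by rw [conj_cis]; congr 1; ring, ?_⟩
  simp only [map_mul, map_sub, map_add, map_neg, Complex.conj_I, Complex.conj_ofReal, conj_cis,
    map_one, neg_mul]
  push_cast
  ring

lemma UnitCCC.flip {σ a μ b : ℝ} {p z : ℂ} (h : UnitCCC σ a μ b p z) :
    UnitCCC σ b μ a (conj p * z) z := by
  obtain ⟨h1, h2, h3, h4, h5, h6, rfl, rfl⟩ := h
  refine ⟨h5, h6, h3, h4, h1, h2, by congr 1; ring, ?_⟩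
  rw [show σ * (a - μ + b) = σ * a + -(σ * μ) + σ * b by ring,
    show σ * (a - μ) = σ * a + -(σ * μ) by ring, show σ * (b - μ) = σ * b + -(σ * μ) by ring]
  simp only [map_mul, map_sub, map_add, map_neg, Complex.conj_I, Complex.conj_ofReal, conj_cis,
    map_one, cis_add]
  have e1 := cis_mul_cis_neg (σ * a)
  have e2 := cis_mul_cis_neg (σ * μ)
  have e3 := cis_mul_cis_neg (σ * b)
  simp only [neg_neg]
  generalize cis (σ * a) = X at *
  generalize cis (-(σ * a)) = X' at *
  generalize cis (σ * μ) = M at *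
  generalize cis (-(σ * μ)) = M' at *
  generalize cis (σ * b) = Y at *
  generalize cis (-(σ * b)) = Y' at *
  linear_combination I * σ * ((2 * M' * Y - 2 * Y * M * M' + M * M' * Y * Y') * e1 +
    (Y * Y' - 2 * Y) * e2 + e3)

lemma Cfg.mirror_CSC {σ₁ σ₃ η S ζ : ℝ} {p z : ℂ} (h : Cfg σ₁ σ₃ η 0 S ζ p z) :
    Cfg (-σ₁) (-σ₃) η 0 S ζ (conj p) (conj z) := by
  obtain ⟨rfl, rfl⟩ := h
  refine ⟨by rw [conj_cis]; congr 1; ring, ?_⟩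
  simp only [map_mul, map_sub, map_add, map_neg, Complex.conj_I, Complex.conj_ofReal, conj_cis,
    map_one, mul_zero, add_zero, neg_mul, map_ofNat]
  push_cast
  ring

lemma UnitCSC.mirror {σ₁ σ₃ η d ζ : ℝ} {p z : ℂ} (h : UnitCSC σ₁ σ₃ η d ζ p z) :
    UnitCSC (-σ₁) (-σ₃) η d ζ (conj p) (conj z) :=
  ⟨h.1, h.2.1, h.2.2.1, h.2.2.2.1, h.2.2.2.2.1, h.2.2.2.2.2.mirror_CSC⟩

lemma UnitCSC.flip {σ₁ σ₃ η d ζ : ℝ} {p z : ℂ} (h : UnitCSC σ₁ σ₃ η d ζ p z) :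
    UnitCSC σ₃ σ₁ ζ d η (conj p * z) z :=
  ⟨h.2.2.2.1, h.2.2.2.2.1, h.2.2.1, h.1, h.2.1, h.2.2.2.2.2.flip⟩

lemma UnitCSC.conn {σ₁ σ₃ η d ζ : ℝ} {p z : ℂ} (h : UnitCSC σ₁ σ₃ η d ζ p z) (h₁ : |σ₁| = 1)
    (h₃ : |σ₃| = 1) : Conn p z (η + d + ζ) := by
  obtain ⟨a, b, c, d', e, f⟩ := h
  have := f.conn h₁ h₃ a b.le d' e.le le_rfl Real.pi_pos (by rw [Real.sin_zero]; linarith)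
  convert this using 1
  simp
  ring

/-! ### Elongation by bending the middle piece -/

/-- All lengths from `l` on are attained, or the total turning `T` is less than `π` and all lengths
from `l` to the length of some `RLR` path are attained. -/
def Climb (p z : ℂ) (l T : ℝ) : Prop :=
  (∀ l', l ≤ l' → Conn p z l') ∨
    (T < Real.pi ∧ ∃ a μ b, UnitCCC (-1) a μ b p z ∧ ∀ l' ∈ Icc l (a + μ + b), Conn p z l')

lemma Climb.of_flip {p z : ℂ} {l T : ℝ} (hz : ‖z‖ = 1) (h : Climb (conj p * z) z l T) :
    Climb p z l T := by
  rcases h with h | ⟨hT, a, μ, b, h, h'⟩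
  · exact .inl fun l' hl => (h l' hl).of_flip hz
  · refine .inr ⟨hT, b, μ, a, ?_, fun l' hl => (h' l' ?_).of_flip hz⟩
    · simpa only [conj_conj_mul_mul hz] using h.flip
    · rwa [show a + μ + b = b + μ + a by ring]

lemma Climb.of_interval {p z : ℂ} {l m T : ℝ} (h : ∀ l' ∈ Icc l m, Conn p z l')
    (h' : Climb p z m T) : Climb p z l T := by
  rcases h' with h' | ⟨hT, a, μ, b, hp, h'⟩
  · refine .inl fun l' hl => ?_
    rcases le_total l' m with hm | hm
    · exact h l' ⟨hl, hm⟩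
    · exact h' l' hm
  · refine .inr ⟨hT, a, μ, b, hp, fun l' hl => ?_⟩
    rcases le_total l' m with hm | hm
    · exact h l' ⟨hl.1, hm⟩
    · exact h' l' ⟨hm, hl.2⟩

/-- Both end arcs turn right: the middle arc may be bent further. -/
lemma Cfg.bend_right_right {a u S b : ℝ} {p z : ℂ} (h : Cfg (-1) (-1) a u S b p z) (v : ℝ) :
    Cfg (-1) (-1) (a + (v - u)) v (S + Real.sin u - Real.sin v) (b + (v - u)) p z := by
  obtain ⟨hz, hp⟩ := h
  refine ⟨by rw [hz]; congr 1; ring, ?_⟩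
  rw [hp, show -1 * (a + (v - u)) = -1 * a + u + -v by ring,
    show -1 * a + u + -v + v = -1 * a + u by ring,
    show -1 * a + u + -v + 2 * v = -1 * a + u + v by ring,
    show -1 * a + 2 * u = -1 * a + u + u by ring,
    show cis (-1 * a) = cis (-1 * a + u + -u) by congr 1; ring]
  simp only [cis_add (-1 * a + u)]
  generalize cis (-1 * a + u) = X
  have h1 := cis_sub_cis_neg u
  have h2 := cis_sub_cis_neg v
  push_cast at h1 h2 ⊢
  linear_combination (-X * I) * h1 + (X * I) * h2 +
    2 * (Complex.sin v - Complex.sin u) * X * I_sq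

/-- Past a half turn of the middle arc `sin v` decreases, so bending lengthens the chord and the
radius stays at least one. -/
lemma Cfg.conn_of_half_turn {a u S b : ℝ} {p z : ℂ} (h : Cfg (-1) (-1) a u S b p z) (ha : 0 ≤ a)
    (ha' : a ≤ 2 * Real.pi) (hb : 0 ≤ b) (hb' : b ≤ 2 * Real.pi) (hu : Real.pi / 2 ≤ u)
    (hu' : u < Real.pi) (hS : Real.sin u ≤ S) :
    ∀ l, a + b + 2 * S * (Real.sinc u)⁻¹ ≤ l → Conn p z l := by
  have hpi := Real.pi_pos
  have hu0 : 0 ≤ u := by linarith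
  have h1 : |(-1 : ℝ)| = 1 := by simp
  have hsin : ∀ v, u ≤ v → v < Real.pi → Real.sin v ≤ Real.sin u := by
    intro v hv hv'
    rw [← Real.sin_pi_sub v, ← Real.sin_pi_sub u]
    exact Real.sin_le_sin_of_le_of_le_pi_div_two (by linarith) (by linarith) (by linarith)
  let f : ℝ → ℝ := fun v => a + (v - u) + (b + (v - u)) +
    2 * (S + Real.sin u - Real.sin v) * (Real.sinc v)⁻¹
  have f0 : f u = a + b + 2 * S * (Real.sinc u)⁻¹ := by simp [f]
  have hfc : ContinuousOn f (Ico u Real.pi) := by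
    have hc := continuousOn_inv_sinc (s := Ico u Real.pi) fun v hv => ⟨hu0.trans hv.1, hv.2⟩
    have hs := Real.continuous_sin.continuousOn (s := Ico u Real.pi)
    fun_prop
  have hconn : ∀ v ∈ Ico u Real.pi, a + (v - u) ≤ 2 * Real.pi → b + (v - u) ≤ 2 * Real.pi →
      Conn p z (f v) := by
    intro v hv h2 h3
    exact (h.bend_right_right v).conn h1 h1 (by linarith [hv.1]) h2 (by linarith [hv.1]) h3
      (hu0.trans hv.1) hv.2 (by linarith [hsin v hv.1 hv.2])
  rw [← f0]
  -- The minimum is the amount of bending that turns an end arc into a full turn. Either `v` tends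
  -- to `π` first, or the bending stops there and the full circle is enlarged.
  rcases le_or_gt Real.pi (u + min (2 * Real.pi - a) (2 * Real.pi - b)) with ht | ht
  · have t1 := min_le_left (2 * Real.pi - a) (2 * Real.pi - b)
    have t2 := min_le_right (2 * Real.pi - a) (2 * Real.pi - b)
    refine conn_of_unbounded (s := Ico u Real.pi) ⟨le_rfl, hu'⟩ hfc (fun M => ?_)
      fun v hv => hconn v hv (by linarith [hv.2]) (by linarith [hv.2])
    have hS0 : 0 < S := (Real.sin_pos_of_pos_of_lt_pi (by linarith) hu').trans_le hS
    obtain ⟨v, hv, hM⟩ := exists_le_inv_sinc (M / (2 * S)) hu0 hu'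
    refine ⟨v, hv, ?_⟩
    have hs := sinc_pos (hu0.trans hv.1) hv.2
    have h3 : M ≤ 2 * S * (Real.sinc v)⁻¹ := by
      rwa [div_le_iff₀' (by positivity)] at hM
    have h4 : 2 * S * (Real.sinc v)⁻¹ ≤ 2 * (S + Real.sin u - Real.sin v) * (Real.sinc v)⁻¹ := by
      gcongr
      linarith [hsin v hv.1 hv.2]
    simp only [f]
    linarith [hv.1]
  · obtain ⟨t, htdef⟩ : ∃ t, t = min (2 * Real.pi - a) (2 * Real.pi - b) := ⟨_, rfl⟩
    rw [← htdef] at ht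
    have ht0 : 0 ≤ t := by rw [htdef]; exact le_min (by linarith) (by linarith)
    have t1 : t ≤ 2 * Real.pi - a := htdef ▸ min_le_left _ _
    have t2 : t ≤ 2 * Real.pi - b := htdef ▸ min_le_right _ _
    intro l hl
    rcases le_total l (f (u + t)) with hl' | hl'
    · refine conn_of_intermediate (f := f) (x₀ := u) (x₁ := u + t) (by linarith)
        (hfc.mono fun v hv => ⟨hv.1, hv.2.trans_lt ht⟩) (fun v hv => ?_) l ⟨hl, hl'⟩
      exact hconn v ⟨hv.1, hv.2.trans_lt ht⟩ (by linarith [hv.2]) (by linarith [hv.2])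
    · have hc := h.bend_right_right (u + t)
      have hs := hsin (u + t) (by linarith) ht
      simp only [f, add_sub_cancel_left] at hl' hc
      rcases min_choice (2 * Real.pi - a) (2 * Real.pi - b) with e | e
      · rw [show a + t = 2 * Real.pi by rw [htdef, e]; ring] at hc hl'
        exact hc.conn_of_loop_first h1 h1 (by linarith) (by linarith) (by linarith) ht
          (by linarith) (by linarith)
      · rw [show b + t = 2 * Real.pi by rw [htdef, e]; ring] at hc hl'
        exact hc.conn_of_loop_last h1 h1 (by linarith) (by linarith) (by linarith) ht
          (by linarith) (by linarith)

lemma sin_mul_inv_sinc {v : ℝ} (h0 : 0 ≤ v) (hv : v < Real.pi) :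
    Real.sin v * (Real.sinc v)⁻¹ = v := by
  rcases h0.eq_or_lt with rfl | h0
  · simp
  · have := Real.sin_pos_of_pos_of_lt_pi h0 hv
    rw [Real.sinc_of_ne_zero h0.ne']
    field_simp

/-- An empty arc has no orientation; thus a vanished left arc can go on growing as a right arc. -/
lemma Cfg.of_zero_first {σ₁ σ₃ u S b : ℝ} {p z : ℂ} (h : Cfg σ₁ σ₃ 0 u S b p z) (σ : ℝ) :
    Cfg σ σ₃ 0 u S b p z := by
  obtain ⟨hz, hp⟩ := h
  refine ⟨by rw [hz]; congr 1; ring, ?_⟩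
  rw [hp]
  simp [cis_zero]

/-- Half the distance between the two right centres, `S + sin u`, is invariant. If it is at least 2,
the middle arc reaches a half turn with radius at least one; otherwise the radius falls to one
earlier. The bounds `π + u` keep the end arcs below a full turn up to `v = π / 2`. -/
lemma Cfg.climb_right_right {a u S b : ℝ} {p z : ℂ} (h : Cfg (-1) (-1) a u S b p z) (ha : 0 ≤ a)
    (ha' : a ≤ Real.pi + u) (hb : 0 ≤ b) (hb' : b ≤ Real.pi + u) (hu : 0 ≤ u)
    (hu' : u < Real.pi) (hS : Real.sin u ≤ S) :
    Climb p z (a + b + 2 * S * (Real.sinc u)⁻¹) (2 * u - a - b) := by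
  have hpi := Real.pi_pos
  have h1 : |(-1 : ℝ)| = 1 := by simp
  rcases le_or_gt (Real.pi / 2) u with hu2 | hu2
  · exact .inl (h.conn_of_half_turn ha (by linarith) hb (by linarith) hu2 hu' hS)
  have hs0 : 0 ≤ Real.sin u := Real.sin_nonneg_of_nonneg_of_le_pi hu hu'.le
  let f : ℝ → ℝ := fun v => a + (v - u) + (b + (v - u)) +
    2 * (S + Real.sin u - Real.sin v) * (Real.sinc v)⁻¹
  have f0 : f u = a + b + 2 * S * (Real.sinc u)⁻¹ := by simp [f]
  have hfc : ContinuousOn f (Icc u (Real.pi / 2)) := by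
    have hc := continuousOn_inv_sinc (s := Icc u (Real.pi / 2)) fun v hv =>
      ⟨hu.trans hv.1, hv.2.trans_lt (by linarith)⟩
    have hs := Real.continuous_sin.continuousOn (s := Icc u (Real.pi / 2))
    fun_prop
  have hconn : ∀ v ∈ Icc u (Real.pi / 2), 2 * Real.sin v ≤ S + Real.sin u →
      Conn p z (f v) := by
    intro v hv h2
    exact (h.bend_right_right v).conn h1 h1 (by linarith [hv.1]) (by linarith [hv.2])
      (by linarith [hv.1]) (by linarith [hv.2]) (hu.trans hv.1) (by linarith [hv.2])
      (by linarith)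
  rw [← f0]
  rcases le_or_gt 2 (S + Real.sin u) with h2 | h2
  · refine Climb.of_interval (conn_of_intermediate hu2.le hfc fun v hv => hconn v hv ?_) (.inl ?_)
    · linarith [Real.sin_le_one v]
    · exact (h.bend_right_right (Real.pi / 2)).conn_of_half_turn (by linarith) (by linarith)
        (by linarith) (by linarith) le_rfl (by linarith) (by rw [Real.sin_pi_div_two]; linarith)
  -- Here the half-chord `S + sin u - sin v` equals `sin v`, that is, the radius is one.
  · obtain ⟨v, hv⟩ : ∃ v, v = Real.arcsin ((S + Real.sin u) / 2) := ⟨_, rfl⟩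
    have hsv : Real.sin v = (S + Real.sin u) / 2 := by
      rw [hv]; exact Real.sin_arcsin (by linarith) (by linarith)
    have huv : u ≤ v := by
      rw [hv]
      exact (Real.le_arcsin_iff_sin_le' ⟨by linarith, hu2.le⟩).2 (by linarith)
    have hv2 : v < Real.pi / 2 := by
      rw [hv]; exact Real.arcsin_lt_pi_div_two.2 (by linarith)
    have hc := h.bend_right_right v
    rw [show S + Real.sin u - Real.sin v = Real.sin v by linarith] at hc
    refine .inr ⟨by linarith, _, _, _, hc.unitCCC (by linarith) (by linarith) (by linarith)
      (by linarith) (by linarith) (by linarith), ?_⟩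
    have e : a + (v - u) + 2 * v + (b + (v - u)) = f v := by
      simp only [f]
      rw [show S + Real.sin u - Real.sin v = Real.sin v by linarith, mul_assoc,
        sin_mul_inv_sinc (by linarith) (by linarith)]
      ring
    rw [e]
    refine conn_of_intermediate huv (hfc.mono (Icc_subset_Icc_right hv2.le)) fun x hx =>
      hconn x ⟨hx.1, hx.2.trans hv2.le⟩ ?_
    have := Real.sin_le_sin_of_le_of_le_pi_div_two (by linarith [hx.1]) hv2.le hx.2
    linarith

/-- Since `k < 1`, the derivative of the arcsine term is at least `-1`. In `Cfg.climb_left_right`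
this keeps the right end arc from shrinking. -/
lemma monotone_add_arcsin_mul_cos {k : ℝ} (h0 : 0 ≤ k) (hk : k < 1) :
    Monotone fun v => v + Real.arcsin (k * Real.cos v) := by
  have habs : ∀ v, |k * Real.cos v| < 1 := fun v => by
    rw [abs_mul, abs_of_nonneg h0]
    nlinarith [Real.abs_cos_le_one v, abs_nonneg (Real.cos v)]
  have hd : ∀ v, HasDerivAt (fun v => v + Real.arcsin (k * Real.cos v))
      (1 + 1 / √(1 - (k * Real.cos v) ^ 2) * (k * -Real.sin v)) v := by
    intro v
    refine (hasDerivAt_id v).add ?_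
    exact (Real.hasDerivAt_arcsin (by linarith [(abs_lt.1 (habs v)).1])
      (by linarith [(abs_lt.1 (habs v)).2])).comp v ((Real.hasDerivAt_cos v).const_mul k)
  refine monotone_of_deriv_nonneg (fun v => (hd v).differentiableAt) fun v => ?_
  rw [(hd v).deriv]
  have hpos : 0 < 1 - (k * Real.cos v) ^ 2 := by
    have := (sq_lt_one_iff_abs_lt_one _).2 (habs v)
    linarith
  have hle : k * Real.sin v ≤ √(1 - (k * Real.cos v) ^ 2) := by
    refine Real.le_sqrt_of_sq_le ?_
    have h2 : (k * Real.sin v) ^ 2 + (k * Real.cos v) ^ 2 = k ^ 2 := by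
      linear_combination k ^ 2 * Real.sin_sq_add_cos_sq v
    nlinarith
  have := (div_le_one (Real.sqrt_pos.2 hpos)).2 hle
  have e : 1 / √(1 - (k * Real.cos v) ^ 2) * (k * -Real.sin v) =
    -(k * Real.sin v / √(1 - (k * Real.cos v) ^ 2)) := by ring
  rw [e]
  linarith

/-- `W` is the distance between the centres of the end circles, and `arcsin (2 / W * cos v)` is the
angle between the line of centres and the middle chord. Fixing both circles determines the
half-chord and the end arcs. -/
lemma Cfg.bend_left_right {a u S b W : ℝ} {p z : ℂ} (h : Cfg 1 (-1) a u S b p z) (hS : 0 ≤ S)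
    (hW : 2 < W) (hWS : W ^ 2 = 4 * S ^ 2 + 4 * Real.cos u ^ 2) (v : ℝ) :
    Cfg 1 (-1)
      (a + u + (Real.arcsin (2 / W * Real.cos v) - Real.arcsin (2 / W * Real.cos u)) - v) v
      (W / 2 * Real.cos (Real.arcsin (2 / W * Real.cos v)))
      (b + (v - u) + (Real.arcsin (2 / W * Real.cos v) - Real.arcsin (2 / W * Real.cos u))) p z := by
  have hk : 0 ≤ 2 / W ∧ 2 / W < 1 := ⟨by positivity, (div_lt_one (by linarith)).2 hW⟩
  have hW0 : W ≠ 0 := by linarith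
  have hsin : ∀ x, W / 2 * Real.sin (Real.arcsin (2 / W * Real.cos x)) = Real.cos x := by
    intro x
    have habs : |2 / W * Real.cos x| ≤ 1 := by
      rw [abs_mul, abs_of_nonneg hk.1]
      nlinarith [Real.abs_cos_le_one x, abs_nonneg (Real.cos x)]
    rw [Real.sin_arcsin (abs_le.1 habs).1 (abs_le.1 habs).2]
    field_simp
  have hcos : W / 2 * Real.cos (Real.arcsin (2 / W * Real.cos u)) = S := by
    rw [← sq_eq_sq₀ (mul_nonneg (by linarith) (Real.cos_arcsin_nonneg _)) hS]
    have h1 := hsin u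
    have h2 := Real.sin_sq_add_cos_sq (Real.arcsin (2 / W * Real.cos u))
    rw [← h1] at hWS
    nlinarith
  have hsu := hsin u
  have hsv := hsin v
  obtain ⟨hz, hp⟩ := h
  generalize Real.arcsin (2 / W * Real.cos v) = y at *
  generalize Real.arcsin (2 / W * Real.cos u) = x at *
  refine ⟨by rw [hz]; congr 1; ring, ?_⟩
  rw [hp]
  -- The vector between the two centres, in the frame of the chord direction.
  have key : ∀ (t c s X : ℝ), W / 2 * Real.cos X = s → W / 2 * Real.sin X = c → c = Real.cos t →
      -I * cis (-t) + 2 * s + I * cis t - 2 * I * cis t = W * cis (-X) := by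
    rintro t c s X rfl rfl h3
    rw [cis_eq_cos_add (-X), Real.cos_neg, Real.sin_neg]
    have h4 := cis_add_cis_neg t
    rw [← h3] at h4
    push_cast at h4 ⊢
    linear_combination (-I) * h4
  have k1 := key u _ _ x hcos hsu rfl
  have k2 := key v _ _ y rfl hsv rfl
  rw [show 1 * (a + u + (y - x) - v) = (a + u) + y + -x + -v by ring,
    show (a + u) + y + -x + -v + v = (a + u) + y + -x by ring,
    show (a + u) + y + -x + -v + 2 * v = (a + u) + y + -x + v by ring,
    show 1 * a + 2 * u = a + u + u by ring, show 1 * a + u = a + u by ring,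
    show 1 * a = a + u + -u by ring]
  simp only [cis_add (a + u), cis_add (a + u + y), cis_add (a + u + y + -x)]
  have hyy := cis_mul_cis_neg y
  have hxx := cis_mul_cis_neg x
  push_cast at k1 k2 ⊢
  generalize cis (a + u) = Z at *
  generalize cis x = X at *
  generalize cis (-x) = X' at *
  generalize cis y = Y at *
  generalize cis (-y) = Y' at *
  linear_combination Z * k1 - Z * Y * X' * k2 - W * Z * X' * hyy

/-- As `W > 2`, the square `W ^ 2 / 4 - cos² v` of the half-chord exceeds `sin² v`, so the curvature
bound never stops the bending. Either the left arc vanishes and `Cfg.climb_right_right` takes over,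
or `v` tends to `π` with the chord bounded below. -/
lemma Cfg.climb_left_right {a u S b : ℝ} {p z : ℂ} (h : Cfg 1 (-1) a u S b p z) (ha : 0 ≤ a)
    (ha' : a ≤ 2 * Real.pi) (hb : 0 ≤ b) (hb' : b ≤ Real.pi) (hu : 0 ≤ u) (hu' : u < Real.pi)
    (hS : Real.sin u < S) :
    Climb p z (a + b + 2 * S * (Real.sinc u)⁻¹) (a + 2 * u - b) := by
  have hpi := Real.pi_pos
  have h1 : |(-1 : ℝ)| = 1 := by simp
  have h1' : |(1 : ℝ)| = 1 := by simp
  have hs0 : 0 ≤ Real.sin u := Real.sin_nonneg_of_nonneg_of_le_pi hu hu'.le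
  obtain ⟨W, hWdef⟩ : ∃ W, W = √(4 * S ^ 2 + 4 * Real.cos u ^ 2) := ⟨_, rfl⟩
  have hWS : W ^ 2 = 4 * S ^ 2 + 4 * Real.cos u ^ 2 := by
    rw [hWdef, Real.sq_sqrt (by positivity)]
  have hW : 2 < W := by
    rw [hWdef]
    apply Real.lt_sqrt_of_sq_lt
    nlinarith [Real.sin_sq_add_cos_sq u]
  have hcfg := h.bend_left_right (hs0.trans hS.le) hW hWS
  have hk : 0 ≤ 2 / W ∧ 2 / W < 1 := ⟨by positivity, (div_lt_one (by linarith)).2 hW⟩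
  let φ : ℝ → ℝ := fun v => Real.arcsin (2 / W * Real.cos v)
  let R : ℝ → ℝ := fun v => W / 2 * Real.cos (φ v)
  let A : ℝ → ℝ := fun v => a + u + (φ v - φ u) - v
  let B : ℝ → ℝ := fun v => b + (v - u) + (φ v - φ u)
  let f : ℝ → ℝ := fun v => A v + B v + 2 * R v * (Real.sinc v)⁻¹
  have hφc : Continuous φ := Real.continuous_arcsin.comp (continuous_const.mul Real.continuous_cos)
  have hRc : Continuous R := continuous_const.mul (Real.continuous_cos.comp hφc)
  have hAc : Continuous A := by fun_prop
  have hBc : Continuous B := by fun_prop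
  have hRsq : ∀ v, R v ^ 2 = W ^ 2 / 4 - Real.cos v ^ 2 := by
    intro v
    have habs : |2 / W * Real.cos v| ≤ 1 := by
      rw [abs_mul, abs_of_nonneg hk.1]
      nlinarith [Real.abs_cos_le_one v, abs_nonneg (Real.cos v)]
    have h2 := Real.sin_sq_add_cos_sq (φ v)
    have h3 : Real.sin (φ v) = 2 / W * Real.cos v :=
      Real.sin_arcsin (abs_le.1 habs).1 (abs_le.1 habs).2
    have h4 : W / 2 * Real.sin (φ v) = Real.cos v := by
      rw [h3]; field_simp
    simp only [R]
    rw [← h4]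
    linear_combination (W ^ 2 / 4) * h2
  have hR0 : ∀ v, 0 ≤ R v := fun v => mul_nonneg (by linarith) (Real.cos_arcsin_nonneg _)
  have hRsin : ∀ v, Real.sin v ≤ R v := by
    intro v
    refine (le_abs_self _).trans (abs_le_of_sq_le_sq ?_ (hR0 v))
    rw [hRsq]
    nlinarith [Real.sin_sq_add_cos_sq v]
  have hRu : R u = S := by
    rw [← sq_eq_sq₀ (hR0 u) (hs0.trans hS.le), hRsq, hWS]; ring
  have hA0 : A u = a := by simp [A]
  have hB0 : B u = b := by simp [B]
  have f0 : f u = a + b + 2 * S * (Real.sinc u)⁻¹ := by simp only [f, hA0, hB0, hRu]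
  have hfc : ContinuousOn f (Ico u Real.pi) := by
    have hc := continuousOn_inv_sinc (s := Ico u Real.pi) fun v hv => ⟨hu.trans hv.1, hv.2⟩
    exact (hAc.add hBc).continuousOn.add ((continuous_const.mul hRc).continuousOn.mul hc)
  have hφanti : ∀ v w, u ≤ v → v ≤ w → w ≤ Real.pi → φ w ≤ φ v := by
    intro v w h2 h3 h4
    refine Real.monotone_arcsin (mul_le_mul_of_nonneg_left ?_ hk.1)
    exact Real.cos_le_cos_of_nonneg_of_le_pi (hu.trans h2) h4 h3
  have hAanti : ∀ v w, u ≤ v → v ≤ w → w ≤ Real.pi → A w ≤ A v := by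
    intro v w h2 h3 h4
    have := hφanti v w h2 h3 h4
    simp only [A]; linarith
  have hBlow : ∀ v, u ≤ v → b ≤ B v := by
    intro v hv
    have : u + φ u ≤ v + φ v := monotone_add_arcsin_mul_cos hk.1 hk.2 hv
    simp only [B]; linarith
  have hBup : ∀ v, u ≤ v → v ≤ Real.pi → B v ≤ b + (v - u) := by
    intro v hv hv'
    have := hφanti u v le_rfl hv hv'
    simp only [B]; linarith
  have hconn : ∀ v ∈ Ico u Real.pi, 0 ≤ A v → Conn p z (f v) := by
    intro v hv hA
    have h2 := hAanti u v le_rfl hv.1 hv.2.le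
    have h3 := hBlow v hv.1
    have h4 := hBup v hv.1 hv.2.le
    exact (hcfg v).conn h1' h1 hA (by change A v ≤ _; linarith) (by change 0 ≤ B v; linarith)
      (by change B v ≤ _; linarith [hv.2]) (hu.trans hv.1) hv.2 (hRsin v)
  rw [← f0]
  by_cases hex : ∃ v ∈ Ico u Real.pi, A v ≤ 0
  · obtain ⟨v, hv, hAv⟩ := hex
    obtain ⟨w, hw, hAw⟩ := intermediate_value_Icc' hv.1 hAc.continuousOn
      (show (0 : ℝ) ∈ Icc (A v) (A u) from ⟨hAv, by rw [hA0]; exact ha⟩)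
    have hwpi : w < Real.pi := hw.2.trans_lt hv.2
    have hsub : Icc u w ⊆ Ico u Real.pi := fun x hx => ⟨hx.1, hx.2.trans_lt hwpi⟩
    refine Climb.of_interval (conn_of_intermediate hw.1 (hfc.mono hsub) fun x hx =>
      hconn x (hsub hx) ?_) ?_
    · rw [← hAw]; exact hAanti x w hx.1 hx.2 hwpi.le
    · have hc : Cfg 1 (-1) (A w) w (R w) (B w) p z := hcfg w
      rw [hAw] at hc
      have h2 := hBlow w hw.1
      have h3 := hBup w hw.1 hwpi.le
      have hc' := (hc.of_zero_first (-1)).climb_right_right le_rfl (by linarith [hw.1])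
        (hb.trans h2) (by linarith) (hu.trans hw.1) hwpi (hRsin w)
      have e : a + 2 * u - b = 2 * w - 0 - B w := by
        simp only [A, B] at hAw ⊢
        linarith
      simp only [f, hAw]
      rw [e]
      exact hc'
  · push Not at hex
    left
    refine conn_of_unbounded (s := Ico u Real.pi) ⟨le_rfl, hu'⟩ hfc (fun M => ?_)
      fun v hv => hconn v hv (hex v hv).le
    obtain ⟨c, hc⟩ : ∃ c, c = √(W ^ 2 / 4 - 1) := ⟨_, rfl⟩
    have hc0 : 0 < c := by rw [hc]; apply Real.sqrt_pos.2; nlinarith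
    have hcR : ∀ v, c ≤ R v := by
      intro v
      refine (le_abs_self _).trans (abs_le_of_sq_le_sq ?_ (hR0 v))
      rw [hRsq, hc, Real.sq_sqrt (by nlinarith)]
      nlinarith [Real.cos_sq_le_one v]
    obtain ⟨v, hv, hM⟩ := exists_le_inv_sinc (M / (2 * c)) hu hu'
    refine ⟨v, hv, ?_⟩
    have hs := sinc_pos (hu.trans hv.1) hv.2
    have h3 : M ≤ 2 * c * (Real.sinc v)⁻¹ := by
      rwa [div_le_iff₀' (by positivity)] at hM
    have h4 : 2 * c * (Real.sinc v)⁻¹ ≤ 2 * R v * (Real.sinc v)⁻¹ := by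
      gcongr
      exact hcR v
    have h5 := hex v hv
    have h6 := hBlow v hv.1
    simp only [f]
    linarith

/-- Both end arcs turn left: the middle arc may be bent further. -/
lemma Cfg.bend_left_left {a u S b : ℝ} {p z : ℂ} (h : Cfg 1 1 a u S b p z) (v : ℝ) :
    Cfg 1 1 (a - (v - u)) v (S + Real.sin v - Real.sin u) (b - (v - u)) p z := by
  obtain ⟨hz, hp⟩ := h
  refine ⟨by rw [hz]; congr 1; ring, ?_⟩
  rw [hp, show 1 * (a - (v - u)) = a + u + -v by ring,
    show a + u + -v + v = a + u by ring, show a + u + -v + 2 * v = a + u + v by ring,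
    show 1 * a + 2 * u = a + u + u by ring, show 1 * a + u = a + u by ring,
    show cis (1 * a) = cis (a + u + -u) by congr 1; ring]
  simp only [cis_add (a + u)]
  generalize cis (a + u) = X
  have h1 := cis_sub_cis_neg u
  have h2 := cis_sub_cis_neg v
  push_cast at h1 h2 ⊢
  linear_combination (X * I) * h1 - (X * I) * h2 -
    2 * (Complex.sin v - Complex.sin u) * X * I_sq

/-- A single left arc as a configuration with end arcs of length zero. -/
lemma Cfg.single_left {T : ℝ} {p z : ℂ} (hz : z = cis T) (hp : p = -I * (cis T - 1)) (σ₁ σ₃ : ℝ) :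
    Cfg σ₁ σ₃ 0 (T / 2) (Real.sin (T / 2)) 0 p z := by
  refine ⟨by rw [hz]; congr 1; ring, ?_⟩
  rw [hp, hz, show σ₁ * 0 + T / 2 = T / 2 by ring, show σ₁ * 0 + 2 * (T / 2) = T by ring]
  have e : cis T - 1 = cis (T / 2) * (2 * I * Real.sin (T / 2)) := by
    rw [← cis_sub_cis_neg, mul_sub, cis_mul_cis_neg, ← cis_add, add_halves]
  rw [e, mul_zero, cis_zero]
  linear_combination (-2 * Real.sin (T / 2) * cis (T / 2)) * I_sq

/-- Both left arcs shrink equally, so the first one vanishes first, unless `η ≥ π` lets `v` tend to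
`π`. After it has vanished, the flipped curve is a left-right configuration with an empty right arc.
The strict chord inequality needed there comes from `d > 0`. -/
lemma UnitCSC.climb_of_le {η d ζ : ℝ} {p z : ℂ} (h : UnitCSC 1 1 η d ζ p z) (hle : η ≤ ζ) :
    Climb p z (η + d + ζ) (η + ζ) := by
  have hpi := Real.pi_pos
  have h1 : |(1 : ℝ)| = 1 := by simp
  obtain ⟨ha, ha', hd, hb, hb', h⟩ := h
  rcases hd.eq_or_lt with rfl | hd
  · have hz : z = cis (η + ζ) := by rw [h.1]; congr 1; ring
    have hp : p = -I * (cis (η + ζ) - 1) := by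
      rw [h.2, ← hz, show 1 * η + 2 * 0 = 1 * η by ring]
      push_cast
      ring
    -- The path is a single left arc: below a full turn it serves as the middle arc between empty
    -- ends, otherwise it contains a loop that can be enlarged.
    rcases lt_or_ge (η + ζ) (2 * Real.pi) with hT | hT
    · have hs : 0 ≤ Real.sin ((η + ζ) / 2) :=
        Real.sin_nonneg_of_nonneg_of_le_pi (by linarith) (by linarith)
      have hc := (Cfg.single_left hz hp (-1) (-1)).climb_right_right le_rfl (by linarith) le_rfl
        (by linarith) (by linarith) (by linarith) le_rfl
      rw [mul_assoc, sin_mul_inv_sinc (by linarith) (by linarith)] at hc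
      convert hc using 1 <;> ring
    · refine .inl fun l hl => ?_
      have hc : Cfg 1 1 (2 * Real.pi) 0 0 (η + ζ - 2 * Real.pi) p z := by
        refine ⟨by rw [hz]; congr 1; ring, ?_⟩
        rw [hp, ← hz, show 1 * (2 * Real.pi) + 2 * 0 = 1 * (2 * Real.pi) by ring]
        push_cast
        ring
      exact hc.conn_of_loop_first h1 h1 (by linarith) (by linarith) le_rfl hpi (by simp)
        (by simp; linarith)
  · let f : ℝ → ℝ := fun v => η - (v - 0) + (ζ - (v - 0)) +
      2 * (d / 2 + Real.sin v - Real.sin 0) * (Real.sinc v)⁻¹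
    have f0 : f 0 = η + d + ζ := by simp [f]; ring
    have hfc : ContinuousOn f (Ico 0 Real.pi) := by
      have hc := continuousOn_inv_sinc (s := Ico 0 Real.pi) fun v hv => ⟨hv.1, hv.2⟩
      have hs := Real.continuous_sin.continuousOn (s := Ico 0 Real.pi)
      fun_prop
    have hconn : ∀ v ∈ Ico 0 Real.pi, v ≤ η → Conn p z (f v) := by
      intro v hv h2
      exact (h.bend_left_left v).conn h1 h1 (by linarith [hv.1]) (by linarith [hv.1])
        (by linarith [hv.1]) (by linarith [hv.1]) hv.1 hv.2 (by rw [Real.sin_zero]; linarith)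
    rw [← f0]
    rcases le_or_gt Real.pi η with hη | hη
    · refine .inl (conn_of_unbounded (s := Ico 0 Real.pi) ⟨le_rfl, hpi⟩ hfc (fun M => ?_)
        fun v hv => hconn v hv (hv.2.le.trans hη))
      obtain ⟨v, hv, hM⟩ := exists_le_inv_sinc (M / d) le_rfl hpi
      refine ⟨v, hv, ?_⟩
      have hs := sinc_pos hv.1 hv.2
      have h3 : M ≤ d * (Real.sinc v)⁻¹ := by
        rwa [div_le_iff₀' (by positivity)] at hM
      have h4 : d * (Real.sinc v)⁻¹ ≤ 2 * (d / 2 + Real.sin v - Real.sin 0) * (Real.sinc v)⁻¹ := by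
        gcongr
        have := Real.sin_nonneg_of_nonneg_of_le_pi hv.1 hv.2.le
        rw [Real.sin_zero]
        linarith
      simp only [f]
      linarith [hv.2]
    · have hsub : Icc 0 η ⊆ Ico 0 Real.pi := fun x hx => ⟨hx.1, hx.2.trans_lt hη⟩
      refine Climb.of_interval (conn_of_intermediate ha (hfc.mono hsub) fun x hx =>
        hconn x (hsub hx) hx.2) ?_
      have hc := h.bend_left_left η
      simp only [sub_zero, sub_self] at hc
      have hc' := (hc.of_zero_first (-1)).flip.climb_left_right (by linarith) (by linarith) le_rfl
        hpi.le ha hη (by rw [Real.sin_zero]; linarith)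
      refine Climb.of_flip h.norm_eq_one ?_
      convert hc' using 1
      · simp only [f]; ring
      · ring

/-- Every `LSL` path can be elongated. -/
lemma UnitCSC.climb_left_left {η d ζ : ℝ} {p z : ℂ} (h : UnitCSC 1 1 η d ζ p z) :
    Climb p z (η + d + ζ) (η + ζ) := by
  rcases le_total η ζ with hle | hle
  · exact h.climb_of_le hle
  · refine Climb.of_flip h.2.2.2.2.2.norm_eq_one ?_
    convert h.flip.climb_of_le hle using 1 <;> ring

lemma UnitCSC.climb_left_right {η d ζ : ℝ} {p z : ℂ} (h : UnitCSC 1 (-1) η d ζ p z)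
    (hη : η < Real.pi) (hζ : ζ < Real.pi) : Climb p z (η + d + ζ) (η - ζ) := by
  have hpi := Real.pi_pos
  obtain ⟨ha, ha', hd, hb, hb', h⟩ := h
  rcases hd.eq_or_lt with rfl | hd
  -- Without a segment, the first left arc itself is the middle arc, of radius one.
  · have hc : Cfg (-1) (-1) 0 (η / 2) (Real.sin (η / 2)) ζ p z := by
      obtain ⟨hz, hp⟩ := h
      refine ⟨by rw [hz]; congr 1; ring, ?_⟩
      have h2 := (Cfg.single_left (T := η) rfl rfl (-1) (-1)).2
      rw [hp]
      rw [show -1 * 0 + 2 * (η / 2) = η by ring] at h2 ⊢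
      simp only [mul_zero, add_zero, one_mul, cis_zero, sub_self, zero_add, zero_div,
        Complex.ofReal_zero, zero_mul, Complex.ofReal_one, mul_one] at h2 ⊢
      linear_combination h2
    have hc' := hc.climb_right_right le_rfl (by linarith) hb (by linarith) (by linarith)
      (by linarith) le_rfl
    rw [mul_assoc, sin_mul_inv_sinc (by linarith) (by linarith)] at hc'
    convert hc' using 1 <;> ring
  · have hc := h.climb_left_right ha (by linarith) hb hζ.le le_rfl hpi
      (by rw [Real.sin_zero]; linarith)
    convert hc using 1
    · simp; ring
    · ring

/-! ### CCC paths from which all greater lengths are attained -/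

lemma exists_cis_eq {y : ℂ} (hy : ‖y‖ = 1) : ∃ a, 0 ≤ a ∧ a < 2 * Real.pi ∧ cis a = y := by
  have h1 : cis (Complex.arg y) = y := by
    have := Complex.norm_mul_exp_arg_mul_I y
    rwa [hy, Complex.ofReal_one, one_mul] at this
  rcases le_or_gt 0 (Complex.arg y) with h | h
  · exact ⟨_, h, by linarith [Complex.arg_le_pi y, Real.pi_pos], h1⟩
  · refine ⟨Complex.arg y + 2 * Real.pi, ?_, by linarith, by rw [cis_add_two_pi, h1]⟩
    linarith [Complex.neg_pi_lt_arg y, Real.pi_pos]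

/-- If the right circles are close to each other, then there is an `RLR` path from whose length on
all lengths are attained. -/
lemma exists_unitCCC_right {p z : ℂ} (hz : ‖z‖ = 1) (hw : ‖p - I * z + I‖ < 4) :
    ∃ a μ b, UnitCCC (-1) a μ b p z ∧ ∀ l, a + μ + b ≤ l → Conn p z l := by
  have hpi := Real.pi_pos
  have h1 : |(-1 : ℝ)| = 1 := by simp
  by_cases hw0 : p - I * z + I = 0
  · obtain ⟨θ, h0, hθ, hθz⟩ := exists_cis_eq (y := conj z) (by simpa using hz)
    have hz' : z = cis (-θ) := by rw [← conj_cis, hθz, Complex.conj_conj]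
    have hp : p = I * z - I := by linear_combination hw0
    -- The right circles coincide; halving the turning `2π + θ` keeps each arc below a full turn.
    refine ⟨(2 * Real.pi + θ) / 2, 0, (2 * Real.pi + θ) / 2, ⟨by linarith, by linarith, le_rfl,
      by linarith, by linarith, by linarith, ?_, ?_⟩, ?_⟩
    · rw [hz', ← cis_sub_two_pi]; congr 1; ring
    · rw [hp, sub_zero]; push_cast; ring
    · intro l hl
      have hc : Cfg (-1) (-1) (2 * Real.pi) 0 0 θ p z := by
        refine ⟨by rw [hz', ← cis_sub_two_pi]; congr 1; ring, ?_⟩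
        rw [hp, show -1 * (2 * Real.pi) + 2 * 0 = -1 * (2 * Real.pi) by ring]
        push_cast
        ring
      exact hc.conn_of_loop_first h1 h1 h0 hθ.le le_rfl hpi (by simp) (by simp; linarith)
  · have hn : 0 < ‖p - I * z + I‖ := norm_pos_iff.2 hw0
    -- The obtuse solution of `4 sin v = ‖p - I z + I‖` makes the middle arc at least a half turn,
    -- as `Cfg.conn_of_half_turn` requires.
    obtain ⟨v, hv⟩ : ∃ v, v = Real.pi - Real.arcsin (‖p - I * z + I‖ / 4) := ⟨_, rfl⟩
    have hsin : Real.sin v = ‖p - I * z + I‖ / 4 := by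
      rw [hv, Real.sin_pi_sub, Real.sin_arcsin (by linarith) (by linarith)]
    have hv1 : Real.pi / 2 ≤ v := by
      rw [hv]; linarith [Real.arcsin_le_pi_div_two (‖p - I * z + I‖ / 4)]
    have hv2 : v < Real.pi := by
      rw [hv]; linarith [Real.arcsin_pos.2 (show 0 < ‖p - I * z + I‖ / 4 by linarith)]
    obtain ⟨θ, hθ⟩ : ∃ θ, θ = Complex.arg (p - I * z + I) := ⟨_, rfl⟩
    have hpolar : p - I * z + I = 4 * Real.sin v * cis θ := by
      have := Complex.norm_mul_exp_arg_mul_I (p - I * z + I)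
      rw [← this, hsin, hθ]
      push_cast
      unfold cis
      ring
    obtain ⟨a, ha, ha', haz⟩ := exists_cis_eq (norm_cis (v - θ))
    obtain ⟨b, hb, hb', hbz⟩ := exists_cis_eq (y := cis (θ + v) * conj z)
      (by simp [norm_cis, hz])
    have ha2 : cis (-a) = cis (θ - v) := by
      rw [← conj_cis, haz, conj_cis]; congr 1; ring
    have hzz : conj z * z = 1 := by
      rw [mul_comm, Complex.mul_conj, Complex.normSq_eq_norm_sq, hz]; simp
    have hb2 : cis (-b) = cis (-(θ + v)) * z := by
      rw [← conj_cis, hbz, map_mul, Complex.conj_conj, conj_cis]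
    have hc : Cfg (-1) (-1) a v (Real.sin v) b p z := by
      constructor
      · rw [show -1 * a + 2 * v + -1 * b = -a + 2 * v + -b by ring, cis_add, cis_add, ha2, hb2,
          ← cis_add, show θ - v + 2 * v = θ + v by ring, ← mul_assoc, cis_mul_cis_neg, one_mul]
      · have e1 : cis (-1 * a) = cis θ * cis (-v) := by
          rw [neg_one_mul, ha2, ← cis_add]; rfl
        have e2 : cis (-1 * a + v) = cis θ := by
          rw [neg_one_mul, cis_add, ha2, ← cis_add]; congr 1; ring
        have e3 : cis (-1 * a + 2 * v) = cis θ * cis v := by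
          rw [neg_one_mul, cis_add, ha2, ← cis_add, ← cis_add]; congr 1; ring
        rw [e1, e2, e3]
        have h4 := cis_sub_cis_neg v
        push_cast at h4 hpolar ⊢
        linear_combination hpolar + I * cis θ * h4 + 2 * Complex.sin v * cis θ * I_sq
    refine ⟨_, _, _, hc.unitCCC ha ha' hb hb' (by linarith) hv2, fun l hl => ?_⟩
    refine hc.conn_of_half_turn ha ha'.le hb hb'.le hv1 hv2 le_rfl l ?_
    rw [mul_assoc, sin_mul_inv_sinc (by linarith) hv2]
    linarith

/-- A full turn on the last circle may be enlarged. -/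
lemma conn_of_loop_last {p z : ℂ} {r₁ x₁ m : ℝ} {q : ℂ} {ℓ l : ℝ} (h₁ : 1 ≤ |r₁|)
    (hx : 0 ≤ r₁ * x₁) (hx' : |x₁| ≤ 2 * Real.pi) (hm : Mid m q ℓ) (hz : z = cis (x₁ + m))
    (hp : p = -I * r₁ * (cis x₁ - 1) + cis x₁ * q) (hl : r₁ * x₁ + ℓ + 2 * Real.pi ≤ l) :
    Conn p z l := by
  refine Conn.of_flip (by rw [hz, norm_cis]) (conn_of_loop_first h₁ hx hx' hm (by rw [hz, add_comm])
    ?_ (by linarith))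
  rw [hp, hz, cis_add]
  simp only [map_mul, map_sub, map_add, map_neg, Complex.conj_I, Complex.conj_ofReal, conj_cis,
      map_one]
  linear_combination (I * r₁ * cis m + conj q * cis m) * cis_mul_cis_neg x₁ + hm.conj_mul_cis

/-! ### Elongation of RSL paths by enlarging the first circle -/

lemma sin_eq_two_mul_half (x : ℝ) : Real.sin x = 2 * Real.sin (x / 2) * Real.cos (x / 2) := by
  rw [← Real.sin_two_mul]; congr 1; ring

lemma cos_eq_one_sub_half (x : ℝ) : Real.cos x = 1 - 2 * Real.sin (x / 2) ^ 2 := by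
  have := Real.cos_two_mul (x / 2)
  rw [Real.cos_sq', show 2 * (x / 2) = x by ring] at this
  linarith

lemma UnitCSC.offset_left_of_right_left {η d ζ : ℝ} {p z : ℂ} (h : UnitCSC (-1) 1 η d ζ p z) :
    p + I * z - I = cis (-η) * (d + 2 * I) - 2 * I := by
  rw [h.2.2.2.2.2.2, show -1 * η + 2 * 0 = -η by ring, show -1 * η + 0 = -η by ring,
    show -1 * η = -η by ring]
  push_cast
  ring

/-- An `RSL` path can be elongated without bound by an enlargement of the first circle, provided the
left circle at the end is on the left of the line through the left circle at the start. -/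
lemma UnitCSC.conn_of_right_left {η d ζ : ℝ} {p z : ℂ} (h : UnitCSC (-1) 1 η d ζ p z)
    (hη : 0 < η) (him : 0 ≤ (p + I * z - I).im) : ∀ l, η + d + ζ ≤ l → Conn p z l := by
  have hpi := Real.pi_pos
  have hoff := h.offset_left_of_right_left
  obtain ⟨-, hη', hd, hζ, hζ', hz, hp⟩ := h
  obtain ⟨t, ht⟩ : ∃ t, t = 2 * Real.pi - η := ⟨_, rfl⟩
  have hcη : cis (-η) = cis t := by rw [ht, ← cis_add_two_pi]; congr 1; ring
  rw [hoff, hcη] at him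
  simp only [Complex.sub_im, Complex.mul_im, Complex.add_re, Complex.add_im, cis_re, cis_im,
    Complex.ofReal_re, Complex.ofReal_im, Complex.mul_re, Complex.I_re, Complex.I_im,
    Complex.re_ofNat, Complex.im_ofNat] at him
  have hs : 0 < Real.sin (t / 2) := Real.sin_pos_of_pos_of_lt_pi (by linarith) (by linarith)
  -- The hypothesis `him` divided by `2 sin (t / 2)`; it forces `t < π`.
  have hG : 2 * Real.sin (t / 2) ≤ d * Real.cos (t / 2) := by
    rw [sin_eq_two_mul_half t, cos_eq_one_sub_half t] at him
    nlinarith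
  have hc : 0 < Real.cos (t / 2) := by
    by_contra hc
    push Not at hc
    nlinarith
  have htpi : t < Real.pi := by
    by_contra htpi
    push Not at htpi
    exact absurd hc (not_lt.2 (Real.cos_nonpos_of_pi_div_two_le_of_le (by linarith) (by linarith)))
  have ht0 : 0 < t := by linarith
  -- At parameter `w` the first circle has radius `1 + K w` and its arc misses `t - w` of a full
  -- turn; the segment has length `D w` and the last arc has grown by `w`. `K` and `D` solve the
  -- imaginary and real parts of the closing equation `e3` below.
  let N : ℝ → ℝ := fun w => Real.sin (w / 2) * (d * Real.cos (w / 2) - 2 * Real.sin (w / 2))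
  let K : ℝ → ℝ := fun w => N w / Real.sin ((t - w) / 2) ^ 2
  let D : ℝ → ℝ := fun w => d * Real.cos w - 2 * Real.sin w + K w * Real.sin (t - w)
  let f : ℝ → ℝ := fun w => (1 + K w) * (2 * Real.pi - (t - w)) + D w + (ζ + w)
  have hst : ∀ w ∈ Ico 0 t, 0 < Real.sin ((t - w) / 2) := fun w hw =>
    Real.sin_pos_of_pos_of_lt_pi (by linarith [hw.2]) (by linarith [hw.1])
  have hsw : ∀ w ∈ Ico 0 t, 0 ≤ Real.sin (w / 2) := fun w hw =>
    Real.sin_nonneg_of_nonneg_of_le_pi (by linarith [hw.1]) (by linarith [hw.2])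
  -- The bound vanishes only to first order at `w = t`, against a square in the denominator of `K`;
  -- so `K` is nonnegative and unbounded.
  have hbr : ∀ w ∈ Ico 0 t, 2 * Real.cos (t / 2) * Real.sin ((t - w) / 2) ≤
      d * Real.cos (w / 2) - 2 * Real.sin (w / 2) := by
    intro w hw
    have e1 : Real.cos (w / 2) = Real.cos (t / 2) * Real.cos ((t - w) / 2) +
        Real.sin (t / 2) * Real.sin ((t - w) / 2) := by
      rw [← Real.cos_sub]; congr 1; ring
    have e2 : Real.sin (w / 2) = Real.sin (t / 2) * Real.cos ((t - w) / 2) -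
        Real.cos (t / 2) * Real.sin ((t - w) / 2) := by
      rw [← Real.sin_sub]; congr 1; ring
    have h3 := hst w hw
    have h4 : 0 ≤ Real.cos ((t - w) / 2) :=
      Real.cos_nonneg_of_neg_pi_div_two_le_of_le (by linarith [hw.2]) (by linarith [hw.1])
    rw [e1, e2]
    have h5 : 0 ≤ (d * Real.cos (t / 2) - 2 * Real.sin (t / 2)) * Real.cos ((t - w) / 2) :=
      mul_nonneg (by linarith) h4
    have h6 : 0 ≤ d * Real.sin (t / 2) * Real.sin ((t - w) / 2) := by positivity
    linarith
  have hN : ∀ w ∈ Ico 0 t, 0 ≤ N w := fun w hw =>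
    mul_nonneg (hsw w hw) ((mul_nonneg (by linarith) (hst w hw).le).trans (hbr w hw))
  have hK : ∀ w ∈ Ico 0 t, 0 ≤ K w := fun w hw => div_nonneg (hN w hw) (sq_nonneg _)
  have hKN : ∀ w ∈ Ico 0 t, K w * (1 - Real.cos (t - w)) =
      d * Real.sin w - 2 * (1 - Real.cos w) := by
    intro w hw
    have e0 : K w * Real.sin ((t - w) / 2) ^ 2 = N w :=
      div_mul_cancel₀ _ (pow_ne_zero 2 (hst w hw).ne')
    rw [cos_eq_one_sub_half (t - w), sin_eq_two_mul_half w, cos_eq_one_sub_half w]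
    simp only [N] at e0
    linear_combination 2 * e0
  have hD : ∀ w ∈ Ico 0 t, d ≤ D w := by
    intro w hw
    have h3 := hst w hw
    have e0 : K w * Real.sin ((t - w) / 2) ^ 2 = N w :=
      div_mul_cancel₀ _ (pow_ne_zero 2 h3.ne')
    have e4 : Real.cos (t / 2) = Real.cos (w / 2) * Real.cos ((t - w) / 2) -
        Real.sin (w / 2) * Real.sin ((t - w) / 2) := by
      rw [← Real.cos_add]; congr 1; ring
    have e5 : Real.sin (t / 2) = Real.sin (w / 2) * Real.cos ((t - w) / 2) +
        Real.cos (w / 2) * Real.sin ((t - w) / 2) := by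
      rw [← Real.sin_add]; congr 1; ring
    -- The growth of the segment is a nonnegative multiple of the slack in `hG`.
    have key : (D w - d) * Real.sin ((t - w) / 2) =
        2 * Real.sin (w / 2) * (d * Real.cos (t / 2) - 2 * Real.sin (t / 2)) := by
      simp only [D]
      simp only [N] at e0
      rw [sin_eq_two_mul_half (t - w), sin_eq_two_mul_half w, cos_eq_one_sub_half w, e4, e5]
      linear_combination 2 * Real.cos ((t - w) / 2) * e0
    have h6 : 0 ≤ (D w - d) * Real.sin ((t - w) / 2) := by
      rw [key]; exact mul_nonneg (mul_nonneg (by norm_num) (hsw w hw)) (by linarith)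
    linarith [nonneg_of_mul_nonneg_left h6 h3]
  have f0 : f 0 = η + d + ζ := by
    simp only [f, D, K, N]
    simp [ht]
  have hfc : ContinuousOn f (Ico 0 t) := by
    have hNc : ContinuousOn N (Ico 0 t) := by
      simp only [N]; fun_prop
    have hKc : ContinuousOn K (Ico 0 t) :=
      hNc.div (by fun_prop) fun w hw => pow_ne_zero 2 (hst w hw).ne'
    have hDc : ContinuousOn D (Ico 0 t) :=
      ContinuousOn.add (by fun_prop) (hKc.mul (by fun_prop))
    exact (((continuousOn_const.add hKc).mul (by fun_prop)).add hDc).add (by fun_prop)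
  have hz' : ∀ w, z = cis (-(2 * Real.pi - (t - w)) + 0 + (ζ + w)) := by
    intro w
    rw [hz, ht]; congr 1; ring
  have hp' : ∀ w ∈ Ico 0 t, p = -I * ((-(1 + K w) : ℝ) : ℂ) * (cis (-(2 * Real.pi - (t - w))) - 1)
      + cis (-(2 * Real.pi - (t - w))) * (D w : ℝ) -
      I * (1 : ℝ) * (z - cis (-(2 * Real.pi - (t - w)) + 0)) := by
    intro w hw
    have e1 : cis (-(2 * Real.pi - (t - w))) = cis (t - w) := by
      rw [← cis_add_two_pi]; congr 1; ring
    have e2 : cis t = cis (t - w) * cis w := by rw [← cis_add]; congr 1; ring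
    have e3 : cis w * (d + 2 * I) - 2 * I - K w * I - D w + K w * I * cis (-(t - w)) = 0 := by
      have h4 := hKN w hw
      have h5 : D w = d * Real.cos w - 2 * Real.sin w + K w * Real.sin (t - w) := rfl
      rw [cis_eq_cos_add, cis_eq_cos_add, Real.cos_neg, Real.sin_neg]
      generalize D w = D' at *
      generalize K w = K' at *
      generalize Real.cos w = x₁ at *
      generalize Real.sin w = x₂ at *
      generalize Real.cos (t - w) = x₃ at *
      generalize Real.sin (t - w) = x₄ at *
      apply Complex.ext
      · simp
        linarith
      · simp
        linarith
    have e4 := cis_mul_cis_neg (t - w)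
    rw [add_zero, e1]
    rw [hcη, e2] at hoff
    push_cast
    linear_combination hoff + cis (t - w) * e3 - K w * I * e4
  have hconn : ∀ w ∈ Ico 0 t, ζ + w ≤ 2 * Real.pi → Conn p z (f w) := by
    intro w hw hle
    have h3 := hK w hw
    have h4 : 0 ≤ 2 * Real.pi - (t - w) := by linarith [hw.1]
    refine ⟨-(1 + K w), -(2 * Real.pi - (t - w)), 1, ζ + w, 0, (D w : ℝ), D w, ?_, ?_, ?_, ?_, ?_,
      ?_, .inl ⟨rfl, hd.trans (hD w hw), rfl⟩, hz' w, hp' w hw, ?_⟩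
    · rw [abs_neg, abs_of_nonneg (by linarith)]; linarith
    · rw [neg_mul_neg]; positivity
    · rw [abs_neg, abs_of_nonneg h4]; linarith [hw.2]
    · simp
    · linarith [hw.1]
    · rw [abs_of_nonneg (by linarith [hw.1])]; exact hle
    · simp only [f]; ring
  rw [← f0]
  rcases le_or_gt (ζ + t) (2 * Real.pi) with hle | hlt
  · refine conn_of_unbounded (s := Ico 0 t) ⟨le_rfl, ht0⟩ hfc (fun M => ?_)
      fun w hw => hconn w hw (by linarith [hw.2])
    obtain ⟨C, hC⟩ : ∃ C, C = 2 * Real.cos (t / 2) * Real.sin (t / 4) := ⟨_, rfl⟩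
    have hs4 : 0 < Real.sin (t / 4) := Real.sin_pos_of_pos_of_lt_pi (by linarith) (by linarith)
    have hC0 : 0 < C := by rw [hC]; positivity
    have hM : 0 < max M 1 := by positivity
    -- At `w = t - y` one has `K ≥ C / y`, and the first arc turns by at least `π`; this `y` makes
    -- their product at least `M`.
    obtain ⟨y, hy⟩ : ∃ y, y = min (t / 2) (C * Real.pi / max M 1) := ⟨_, rfl⟩
    have hy0 : 0 < y := by rw [hy]; exact lt_min (by linarith) (by positivity)
    have hy1 : y ≤ t / 2 := hy ▸ min_le_left _ _
    have hy2 : y ≤ C * Real.pi / max M 1 := hy ▸ min_le_right _ _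
    have hw : t - y ∈ Ico 0 t := ⟨by linarith, by linarith⟩
    refine ⟨t - y, hw, ?_⟩
    have h3 := hst _ hw
    have h4 := hbr _ hw
    have h5 : Real.sin (t / 4) ≤ Real.sin ((t - y) / 2) :=
      Real.sin_le_sin_of_le_of_le_pi_div_two (by linarith) (by linarith) (by linarith)
    rw [show (t - (t - y)) / 2 = y / 2 by ring] at h3 h4
    have h6 : C / Real.sin (y / 2) ≤ K (t - y) := by
      simp only [K, N]
      rw [show (t - (t - y)) / 2 = y / 2 by ring, div_le_div_iff₀ h3 (by positivity), hC]
      have h7 : Real.sin (t / 4) * (2 * Real.cos (t / 2) * Real.sin (y / 2)) ≤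
          Real.sin ((t - y) / 2) *
            (d * Real.cos ((t - y) / 2) - 2 * Real.sin ((t - y) / 2)) :=
        mul_le_mul h5 h4 (by positivity) (hs4.le.trans h5)
      nlinarith
    have h8 : Real.sin (y / 2) ≤ y := (Real.sin_le (by linarith)).trans (by linarith)
    have h9 : C / y ≤ K (t - y) := (div_le_div_of_nonneg_left hC0.le h3 h8).trans h6
    have h10 : max M 1 ≤ Real.pi * (C / y) := by
      rw [le_div_iff₀ hM] at hy2
      rw [← mul_div_assoc, le_div_iff₀ hy0]
      linarith
    have h11 := hD _ hw
    have h12 : Real.pi * (C / y) ≤ (1 + K (t - y)) * (2 * Real.pi - (t - (t - y))) := by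
      rw [mul_comm]
      refine mul_le_mul (by linarith) (by linarith) hpi.le (by linarith [hK _ hw])
    have h13 := le_max_left M 1
    simp only [f]
    linarith
  -- At this `w` the last arc is a full turn; for greater lengths its circle is enlarged instead.
  · have hw : 2 * Real.pi - ζ ∈ Ico 0 t := ⟨by linarith, by linarith⟩
    intro l hl
    rcases le_total l (f (2 * Real.pi - ζ)) with hl' | hl'
    · refine conn_of_intermediate (f := f) hw.1
        (hfc.mono fun v hv => ⟨hv.1, hv.2.trans_lt hw.2⟩) (fun v hv => ?_) l ⟨hl, hl'⟩
      exact hconn v ⟨hv.1, hv.2.trans_lt hw.2⟩ (by linarith [hv.2])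
    · have h3 := hK _ hw
      have h4 : 0 ≤ 2 * Real.pi - (t - (2 * Real.pi - ζ)) := by linarith
      have h5 := hz' (2 * Real.pi - ζ)
      have h6 := hp' _ hw
      rw [show ∀ x : ℝ, x + (ζ + (2 * Real.pi - ζ)) = x + 2 * Real.pi by intro x; ring,
        cis_add_two_pi] at h5
      refine conn_of_loop_last (r₁ := -(1 + K (2 * Real.pi - ζ)))
        (x₁ := -(2 * Real.pi - (t - (2 * Real.pi - ζ)))) (m := 0) (q := (D (2 * Real.pi - ζ) : ℝ))
        (ℓ := D (2 * Real.pi - ζ)) ?_ ?_ ?_ (.inl ⟨rfl, hd.trans (hD _ hw), rfl⟩) h5 ?_ ?_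
      · rw [abs_neg, abs_of_nonneg (by linarith)]; linarith
      · rw [neg_mul_neg]; positivity
      · rw [abs_neg, abs_of_nonneg h4]; linarith [hw.2]
      · rw [h6, ← h5]; simp
      · simp only [f] at hl'
        linarith

/-! ### Offsets of the centres and the reduced statement for one CSC path -/

lemma UnitCSC.offset_left_of_left_left {η d ζ : ℝ} {p z : ℂ} (h : UnitCSC 1 1 η d ζ p z) :
    p + I * z - I = cis η * d := by
  rw [h.2.2.2.2.2.2, show 1 * η + 2 * 0 = η by ring, show 1 * η + 0 = η by ring,
    show 1 * η = η by ring]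
  push_cast
  ring

lemma UnitCSC.offset_of_left_right {η d ζ : ℝ} {p z : ℂ} (h : UnitCSC 1 (-1) η d ζ p z) :
    p - I * z - I = cis η * (d - 2 * I) := by
  rw [h.2.2.2.2.2.2, show 1 * η + 2 * 0 = η by ring, show 1 * η + 0 = η by ring,
    show 1 * η = η by ring]
  push_cast
  ring

lemma UnitCSC.offset_left_of_left_right {η d ζ : ℝ} {p z : ℂ} (h : UnitCSC 1 (-1) η d ζ p z) :
    p + I * z - I = cis η * (d + 4 * Real.sin (ζ / 2) * cis (-(ζ / 2))) := by
  have h1 := h.offset_of_left_right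
  have h2 : z = cis η * (cis (-(ζ / 2)) * cis (-(ζ / 2))) := by
    rw [h.2.2.2.2.2.1, ← cis_add, ← cis_add]; congr 1; ring
  have h3 := cis_sub_cis_neg (ζ / 2)
  have h4 := cis_mul_cis_neg (ζ / 2)
  linear_combination h1 + 2 * I * h2 - 2 * I * cis η * cis (-(ζ / 2)) * h3 +
    2 * I * cis η * h4 - 4 * Real.sin (ζ / 2) * cis η * cis (-(ζ / 2)) * I_sq

lemma UnitCSC.norm_eq_one {σ₁ σ₃ η d ζ : ℝ} {p z : ℂ} (h : UnitCSC σ₁ σ₃ η d ζ p z) : ‖z‖ = 1 :=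
  h.2.2.2.2.2.norm_eq_one

lemma UnitCSC.heading {σ₁ σ₃ η d ζ : ℝ} {p z : ℂ} (h : UnitCSC σ₁ σ₃ η d ζ p z) :
    z = cis (σ₁ * η + σ₃ * ζ) := by
  rw [h.2.2.2.2.2.1]; congr 1; ring

lemma Climb.conn {p z : ℂ} {l m T : ℝ} (h : Climb p z l T) (hm : l ≤ m)
    (h' : ∀ a μ b, UnitCCC (-1) a μ b p z → m ≤ a + μ + b) : Conn p z m := by
  rcases h with h | ⟨-, a, μ, b, hp, h⟩
  · exact h m hm
  · exact h m ⟨hm, h' a μ b hp⟩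

lemma Climb.conn_of_pi_le {p z : ℂ} {l m T : ℝ} (h : Climb p z l T) (hT : Real.pi ≤ T)
    (hm : l ≤ m) : Conn p z m := by
  rcases h with h | ⟨h, -⟩
  · exact h m hm
  · linarith

/-- Reversal of the curve. -/
lemma Conn.of_reverse {p z : ℂ} {l : ℝ} (hz : ‖z‖ = 1)
    (h : Conn (conj (conj p * z)) (conj z) l) : Conn p z l :=
  (Conn.of_mirror h).of_flip hz

lemma UnitCSC.reverse {σ₁ σ₃ η d ζ : ℝ} {p z : ℂ} (h : UnitCSC σ₁ σ₃ η d ζ p z) :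
    UnitCSC (-σ₃) (-σ₁) ζ d η (conj (conj p * z)) (conj z) :=
  h.flip.mirror

lemma UnitCCC.reverse {σ a μ b : ℝ} {p z : ℂ} (h : UnitCCC σ a μ b p z) :
    UnitCCC (-σ) b μ a (conj (conj p * z)) (conj z) :=
  h.flip.mirror

/-- An `RSR` path is elongated to an `RLR` path. -/
lemma UnitCSC.climb_right_right {η d ζ : ℝ} {p z : ℂ} (h : UnitCSC (-1) (-1) η d ζ p z)
    (hη : η ≤ Real.pi) (hζ : ζ ≤ Real.pi) : Climb p z (η + d + ζ) (-η - ζ) := by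
  obtain ⟨ha, -, hd, hb, -, h⟩ := h
  have hc := h.climb_right_right ha (by linarith) hb (by linarith) le_rfl Real.pi_pos
    (by rw [Real.sin_zero]; linarith)
  convert hc using 1
  · simp; ring
  · ring

/-- The statement on the attained lengths, in terms of a length `m` of a `CSC` path. -/
def Attained (p z : ℂ) (m : ℝ) : Prop :=
  ∀ l, m ≤ l → ((∃ σ : ℝ, (σ = 1 ∨ σ = -1) ∧ ∀ a μ b, UnitCCC σ a μ b p z → l ≤ a + μ + b) ∨
    m + 2 * Real.pi ≤ l ∨
    ∃ σ₁ σ₃ η d ζ : ℝ, (σ₁ = 1 ∨ σ₁ = -1) ∧ (σ₃ = 1 ∨ σ₃ = -1) ∧ UnitCSC σ₁ σ₃ η d ζ p z ∧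
      η + d + ζ ≠ m ∧ η + d + ζ ≤ l) → Conn p z l

lemma Attained.of_mirror {p z : ℂ} {m : ℝ} (h : Attained (conj p) (conj z) m) : Attained p z m := by
  intro l hl hc
  refine Conn.of_mirror (h l hl ?_)
  rcases hc with ⟨σ, hσ, hc⟩ | hc | ⟨σ₁, σ₃, η, d, ζ, h1, h3, hc, hm⟩
  · refine .inl ⟨-σ, by rcases hσ with rfl | rfl <;> simp, fun a μ b hp => hc a μ b ?_⟩
    simpa using hp.mirror
  · exact .inr (.inl hc)
  · refine .inr (.inr ⟨-σ₁, -σ₃, η, d, ζ, ?_, ?_, hc.mirror, hm⟩)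
    · rcases h1 with rfl | rfl <;> simp
    · rcases h3 with rfl | rfl <;> simp

/-- By `hm` the turning is at least `π`, and then `Climb` cannot end in an RLR path. -/
lemma conn_of_left_left_of_ne {m : ℝ} {p z : ℂ}
    (hm : ∀ η d ζ, UnitCSC 1 1 η d ζ p z → η + ζ < Real.pi → η + d + ζ = m) {η d ζ l : ℝ}
    (h : UnitCSC 1 1 η d ζ p z) (hne : η + d + ζ ≠ m) (hl : η + d + ζ ≤ l) : Conn p z l := by
  rcases lt_or_ge (η + ζ) Real.pi with hT | hT
  · exact absurd (hm η d ζ h hT) hne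
  · exact h.climb_left_left.conn_of_pi_le hT hl

/-- With an empty first arc the path is also of type LSL; otherwise its first circle can be
enlarged. -/
lemma conn_of_right_left_of_ne {m : ℝ} {p z : ℂ}
    (hm : ∀ η d ζ, UnitCSC 1 1 η d ζ p z → η + ζ < Real.pi → η + d + ζ = m)
    (him : 0 ≤ (p + I * z - I).im) {η d ζ l : ℝ}
    (h : UnitCSC (-1) 1 η d ζ p z) (hne : η + d + ζ ≠ m) (hl : η + d + ζ ≤ l) : Conn p z l := by
  rcases h.1.eq_or_lt with rfl | hη
  · refine conn_of_left_left_of_ne hm (d := d) (ζ := ζ) (η := 0) ?_ hne hl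
    exact ⟨h.1, h.2.1, h.2.2.1, h.2.2.2.1, h.2.2.2.2.1, h.2.2.2.2.2.of_zero_first 1⟩
  · exact h.conn_of_right_left hη him l hl

/-! ### A path of type `LSL` -/

/-- The heading fixes `η + ζ`, and the distance between the left centres fixes `d`. -/
lemma UnitCSC.eq_of_left_left {η d ζ η' d' ζ' : ℝ} {p z : ℂ} (h : UnitCSC 1 1 η d ζ p z)
    (hT : η + ζ < Real.pi) (h' : UnitCSC 1 1 η' d' ζ' p z) (hT' : η' + ζ' < Real.pi) :
    η' + d' + ζ' = η + d + ζ := by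
  have e1 := h.heading
  rw [h'.heading] at e1
  have e2 := eq_of_cis_eq e1 (abs_lt.2 ⟨by linarith [h'.1, h'.2.2.2.1], by linarith [h.1, h.2.2.2.1]⟩)
  have e3 := congrArg norm (h.offset_left_of_left_left.symm.trans h'.offset_left_of_left_left)
  simp only [norm_mul, norm_cis, one_mul, Complex.norm_real, Real.norm_of_nonneg h.2.2.1,
    Real.norm_of_nonneg h'.2.2.1] at e3
  linarith

/-- A left and a right turning, both below `π`, agree modulo `2π` only if both vanish; the two paths
are then the same segment. -/
lemma UnitCSC.eq_of_left_left_of_right_right {η d ζ η' d' ζ' : ℝ} {p z : ℂ}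
    (h : UnitCSC 1 1 η d ζ p z) (hT : η + ζ < Real.pi) (h' : UnitCSC (-1) (-1) η' d' ζ' p z)
    (hT' : η' + ζ' < Real.pi) : η' + d' + ζ' = η + d + ζ := by
  have hpi := Real.pi_pos
  have e1 := h.heading
  rw [h'.heading] at e1
  have e2 := eq_of_cis_eq e1 (abs_lt.2 ⟨by linarith, by linarith [h.1, h.2.2.2.1, h'.1, h'.2.2.2.1]⟩)
  have z1 : η = 0 := by linarith [h.1, h.2.2.2.1, h'.1, h'.2.2.2.1]
  have z2 : ζ = 0 := by linarith [h.1, h.2.2.2.1, h'.1, h'.2.2.2.1]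
  have z3 : η' = 0 := by linarith [h.1, h.2.2.2.1, h'.1, h'.2.2.2.1]
  have z4 : ζ' = 0 := by linarith [h.1, h.2.2.2.1, h'.1, h'.2.2.2.1]
  subst z1 z2 z3 z4
  have e3 := h.2.2.2.2.2.2
  rw [h'.2.2.2.2.2.2, h.heading] at e3
  simp [cis_zero] at e3
  rw [e3]

/-- There is an RSL path of length at most `η + d + ζ + 2π`, with first arc `2π - t`, to which
`UnitCSC.conn_of_right_left` applies. If `t = 0`, a full first turn is inserted instead. -/
lemma UnitCSC.conn_add_two_pi_of_left_left {η d ζ l : ℝ} {p z : ℂ} (h : UnitCSC 1 1 η d ζ p z)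
    (hT : η + ζ < Real.pi) (hl : η + d + ζ + 2 * Real.pi ≤ l) : Conn p z l := by
  have hpi := Real.pi_pos
  have h1 : |(1 : ℝ)| = 1 := by simp
  have hoff := h.offset_left_of_left_left
  have hz := h.heading
  obtain ⟨ha, ha', hd, hb, hb', hc⟩ := h
  have hsη : 0 ≤ Real.sin η := Real.sin_nonneg_of_nonneg_of_le_pi ha (by linarith)
  -- The equation says that a segment leaving the right circle in direction `t` is tangent to the
  -- left circle at the end.
  obtain ⟨t, ht, htg⟩ : ∃ t ∈ Icc 0 η, d * Real.sin (η - t) - 2 * (1 - Real.cos t) = 0 := by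
    refine intermediate_value_Icc' (f := fun t => d * Real.sin (η - t) - 2 * (1 - Real.cos t)) ha
      (by fun_prop) ⟨?_, ?_⟩
    · simp only [sub_self, Real.sin_zero]
      linarith [Real.cos_le_one η]
    · simp only [sub_zero, Real.cos_zero]
      have := mul_nonneg hd hsη
      linarith
  obtain ⟨d', hd'⟩ : ∃ d', d' = d * Real.cos (η - t) + 2 * Real.sin t := ⟨_, rfl⟩
  have hst : 0 ≤ Real.sin t := Real.sin_nonneg_of_nonneg_of_le_pi ht.1 (by linarith [ht.2])
  rcases ht.1.eq_or_lt with ht0 | ht0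
  · have hdη : d * Real.sin η = 0 := by
      rw [← ht0] at htg; simpa using htg
    have hc' : Cfg 1 1 (2 * Real.pi) 0 (d / 2) (η + ζ) p z := by
      refine ⟨by rw [hz, ← cis_add_two_pi]; congr 1; ring, ?_⟩
      have hp : p = I - I * z + cis η * d := by linear_combination hoff
      have hdd : cis η * d = d := by
        rcases mul_eq_zero.1 hdη with rfl | hη
        · simp
        · have : η = 0 := by
            by_contra hne
            exact (Real.sin_pos_of_pos_of_lt_pi (lt_of_le_of_ne ha (Ne.symm hne))
              (by linarith)).ne' hη
          rw [this, cis_zero, one_mul]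
      rw [hp, hdd, show 1 * (2 * Real.pi) + 0 = 2 * Real.pi by ring,
        show 1 * (2 * Real.pi) + 2 * 0 = 2 * Real.pi by ring,
        show 1 * (2 * Real.pi) = 2 * Real.pi by ring, cis_two_pi]
      push_cast
      ring
    exact hc'.conn_of_loop_first h1 h1 (by linarith) (by linarith) le_rfl hpi
      (by rw [Real.sin_zero]; linarith) (by simp; linarith)
  · have hd'0 : 0 ≤ d' := by
      rcases ht.2.eq_or_lt with hη | hη
      · rw [hd', ← hη]; simp; linarith
      · have hs : 0 < Real.sin (η - t) :=
          Real.sin_pos_of_pos_of_lt_pi (by linarith) (by linarith)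
        have e : Real.cos η = Real.cos (η - t) * Real.cos t - Real.sin (η - t) * Real.sin t := by
          rw [← Real.cos_add]; congr 1; ring
        have hcos : Real.cos η ≤ Real.cos (η - t) :=
          Real.cos_le_cos_of_nonneg_of_le_pi (by linarith) (by linarith) (by linarith)
        have key : d' * Real.sin (η - t) = 2 * (Real.cos (η - t) - Real.cos η) := by
          rw [hd', e]
          linear_combination Real.cos (η - t) * htg
        exact nonneg_of_mul_nonneg_left (by rw [key]; linarith) hs
    have hR : UnitCSC (-1) 1 (2 * Real.pi - t) d' (η + ζ - t) p z := by
      refine ⟨by linarith [ht.2], by linarith, hd'0, by linarith [ht.2], by linarith [ht.1],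
        ?_, ?_⟩
      · rw [hz, ← cis_sub_two_pi]; congr 1; ring
      · have e1 : cis (-1 * (2 * Real.pi - t)) = cis t := by
          rw [← cis_sub_two_pi t]; congr 1; ring
        have e2 : cis η = cis t * cis (η - t) := by rw [← cis_add]; congr 1; ring
        have e3 : d * cis (η - t) + 2 * I * cis (-t) = d' + 2 * I := by
          rw [cis_eq_cos_add, cis_eq_cos_add, Real.cos_neg, Real.sin_neg]
          generalize Real.cos (η - t) = x₁ at *
          generalize Real.sin (η - t) = x₂ at *
          generalize Real.cos t = x₃ at *
          generalize Real.sin t = x₄ at *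
          apply Complex.ext
          · simp; linarith
          · simp; linarith
        have e4 := cis_mul_cis_neg t
        rw [add_zero, mul_zero, add_zero, e1]
        rw [e2] at hoff
        push_cast
        linear_combination hoff + cis t * e3 - 2 * I * e4
    refine hR.conn_of_right_left (by linarith [ht.2]) ?_ l ?_
    · rw [hoff]
      simp only [Complex.mul_im, cis_re, cis_im, Complex.ofReal_re, Complex.ofReal_im]
      have := mul_nonneg hd hsη
      linarith
    -- The arcs save `2 * t`, and the segment gains at most `2 * sin t`.
    · have h2 : d * Real.cos (η - t) ≤ d := mul_le_of_le_one_right hd (Real.cos_le_one _)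
      have h3 := Real.sin_le ht.1
      linarith

theorem UnitCSC.attained_left_left {η d ζ : ℝ} {p z : ℂ} (h : UnitCSC 1 1 η d ζ p z)
    (hη : η < Real.pi) (hζ : ζ < Real.pi) : Attained p z (η + d + ζ) := by
  intro l hl hc
  have hup := h.climb_left_left
  rcases le_or_gt Real.pi (η + ζ) with hT | hT
  · exact hup.conn_of_pi_le hT hl
  have hLSL : ∀ η' d' ζ', UnitCSC 1 1 η' d' ζ' p z → η' + ζ' < Real.pi →
      η' + d' + ζ' = η + d + ζ := fun η' d' ζ' h' hT' => h.eq_of_left_left hT h' hT'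
  have hz := h.norm_eq_one
  have hT' : ζ + η < Real.pi := by linarith
  have him : ∀ {η d ζ : ℝ} {p z : ℂ}, UnitCSC 1 1 η d ζ p z → η < Real.pi →
      0 ≤ (p + I * z - I).im := by
    intro η d ζ p z h hη
    rw [h.offset_left_of_left_left]
    simp only [Complex.mul_im, cis_re, cis_im, Complex.ofReal_re, Complex.ofReal_im]
    have := mul_nonneg (Real.sin_nonneg_of_nonneg_of_le_pi h.1 hη.le) h.2.2.1
    linarith
  rcases hc with ⟨σ, hσ, hc⟩ | hc | ⟨σ₁, σ₃, η', d', ζ', h1, h3, hc, hne, hle⟩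
  · rcases hσ with rfl | rfl
    -- To reach LRL lengths the segment is bent to the right: in the mirror image this is RSR
    -- climbing to RLR.
    · refine Conn.of_mirror (h.mirror.climb_right_right hη.le hζ.le |>.conn hl fun a μ b hp => ?_)
      exact hc a μ b (by simpa using hp.mirror)
    · exact hup.conn hl hc
  · exact h.conn_add_two_pi_of_left_left hT hc
  · rcases h1 with rfl | rfl <;> rcases h3 with rfl | rfl
    · exact conn_of_left_left_of_ne hLSL hc hne hle
    · refine Conn.of_flip hz (conn_of_right_left_of_ne (m := η + d + ζ) (fun η₁ d₁ ζ₁ h₁ hT₁ => ?_)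
        (him h.flip hζ) hc.flip (by rwa [show ζ' + d' + η' = η' + d' + ζ' by ring])
        (by linarith))
      rw [h.flip.eq_of_left_left hT' h₁ hT₁]; ring
    · exact conn_of_right_left_of_ne hLSL (him h hη) hc hne hle
    · rcases lt_or_ge (η' + ζ') Real.pi with hT₁ | hT₁
      · exact absurd (h.eq_of_left_left_of_right_right hT hc hT₁) hne
      · have hm := hc.mirror
        rw [neg_neg] at hm
        exact Conn.of_mirror (hm.climb_left_left.conn_of_pi_le hT₁ hle)

/-! ### A path of type `LSR` -/

/-- The vector from the left centre at the start to the right centre at the end fixes `d` by its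
length and `η` by its direction; the heading then fixes `ζ`. -/
lemma UnitCSC.eq_of_left_right {η d ζ η' d' ζ' : ℝ} {p z : ℂ} (h : UnitCSC 1 (-1) η d ζ p z)
    (h' : UnitCSC 1 (-1) η' d' ζ' p z) : η' + d' + ζ' = η + d + ζ := by
  have e := h.offset_of_left_right.symm.trans h'.offset_of_left_right
  have e3 := congrArg Complex.normSq e
  rw [Complex.normSq_mul, Complex.normSq_mul, Complex.normSq_eq_norm_sq (cis η),
    Complex.normSq_eq_norm_sq (cis η'), norm_cis, norm_cis] at e3
  simp [Complex.normSq_apply] at e3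
  have hd : d' = d := by nlinarith [h.2.2.1, h'.2.2.1]
  subst hd
  have hne : (d' : ℂ) - 2 * I ≠ 0 := by
    intro h0
    have := congrArg Complex.im h0
    simp at this
  have e4 := eq_of_cis_eq (mul_right_cancel₀ hne e)
    (abs_lt.2 ⟨by linarith [h.1, h'.2.1], by linarith [h.2.1, h'.1]⟩)
  have e5 := h.heading
  rw [h'.heading] at e5
  have e6 := eq_of_cis_eq e5
    (abs_lt.2 ⟨by linarith [h.2.2.2.1, h'.2.2.2.2.1], by linarith [h.2.2.2.2.1, h'.2.2.2.1]⟩)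
  linarith

/-- In the frame of the final direction, the offset of the left centres has imaginary part at least
zero by the LSR path and at most zero by the LSL path. This forces `ζ = 0`. -/
lemma UnitCSC.eq_of_left_right_of_left_left {η d ζ η' d' ζ' : ℝ} {p z : ℂ}
    (h : UnitCSC 1 (-1) η d ζ p z) (hη : η < Real.pi) (hζ : ζ < Real.pi)
    (h' : UnitCSC 1 1 η' d' ζ' p z) (hT' : η' + ζ' < Real.pi) :
    η' + d' + ζ' = η + d + ζ := by
  have hpi := Real.pi_pos
  have e1 := h.heading
  rw [h'.heading] at e1
  have e2 := eq_of_cis_eq e1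
    (abs_lt.2 ⟨by linarith [h'.1, h'.2.2.2.1, h.2.2.2.1], by linarith [h.1]⟩)
  have e3 := h.offset_left_of_left_right.symm.trans h'.offset_left_of_left_left
  rw [show η' = η + (-ζ + -ζ') by linarith, cis_add, mul_assoc (cis η) (cis (-ζ + -ζ'))] at e3
  have e4 := mul_left_cancel₀ (cis_ne_zero η) e3
  have e5 : cis ζ * (d + 4 * Real.sin (ζ / 2) * cis (-(ζ / 2))) = cis (-ζ') * d' := by
    rw [e4, cis_add]
    linear_combination cis (-ζ') * d' * cis_mul_cis_neg ζ
  have e6 : cis ζ * cis (-(ζ / 2)) = cis (ζ / 2) := by rw [← cis_add]; congr 1; ring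
  have e7 : d * cis ζ + 4 * Real.sin (ζ / 2) * cis (ζ / 2) = cis (-ζ') * d' := by
    rw [← e5, ← e6]; ring
  have e8 := congrArg Complex.im e7
  simp only [Complex.add_im, Complex.mul_im, cis_re, cis_im, Complex.ofReal_re, Complex.ofReal_im,
    Complex.mul_re, Complex.re_ofNat, Complex.im_ofNat, Real.sin_neg] at e8
  have s1 : 0 ≤ Real.sin ζ' * d' := mul_nonneg
    (Real.sin_nonneg_of_nonneg_of_le_pi h'.2.2.2.1 (by linarith [h'.1])) h'.2.2.1
  have s2 : 0 ≤ d * Real.sin ζ := mul_nonneg h.2.2.1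
    (Real.sin_nonneg_of_nonneg_of_le_pi h.2.2.2.1 hζ.le)
  have hs : Real.sin (ζ / 2) = 0 := by nlinarith
  have hζ0 : ζ = 0 := by
    by_contra hne
    exact (Real.sin_pos_of_pos_of_lt_pi (x := ζ / 2)
      (by linarith [lt_of_le_of_ne h.2.2.2.1 (Ne.symm hne)]) (by linarith)).ne' hs
  subst hζ0
  have e9 := congrArg norm e7
  simp [cis_zero, norm_cis, abs_of_nonneg h.2.2.1, abs_of_nonneg h'.2.2.1] at e9
  linarith

/-- The offset is a nonnegative combination of the directions `η` and `η - ζ / 2`, both in the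
closed upper half-plane. If `2 * η < ζ`, the reversed path qualifies instead. -/
lemma UnitCSC.im_offset_of_left_right {η d ζ : ℝ} {p z : ℂ}
    (h : UnitCSC 1 (-1) η d ζ p z) (hη : η < Real.pi) (hle : ζ ≤ 2 * η) :
    0 ≤ (p + I * z - I).im := by
  have e : cis η * (d + 4 * Real.sin (ζ / 2) * cis (-(ζ / 2))) =
      d * cis η + 4 * Real.sin (ζ / 2) * cis (η - ζ / 2) := by
    rw [sub_eq_add_neg, cis_add]; ring
  rw [h.offset_left_of_left_right, e]
  simp only [Complex.add_im, Complex.mul_im, cis_re, cis_im, Complex.ofReal_re, Complex.ofReal_im,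
    Complex.mul_re, Complex.re_ofNat, Complex.im_ofNat]
  have s1 : 0 ≤ d * Real.sin η := mul_nonneg h.2.2.1
    (Real.sin_nonneg_of_nonneg_of_le_pi h.1 hη.le)
  have s2 : 0 ≤ Real.sin (ζ / 2) :=
    Real.sin_nonneg_of_nonneg_of_le_pi (by linarith [h.2.2.2.1]) (by linarith [h.2.2.2.1])
  have s3 : 0 ≤ Real.sin (η - ζ / 2) :=
    Real.sin_nonneg_of_nonneg_of_le_pi (by linarith) (by linarith [h.2.2.2.1])
  have s4 := mul_nonneg s2 s3
  linarith

/-- For `ζ > 0` there is an LSL path with turning `2π + η - ζ > π`, which climbs without bound. Its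
segment is at most `d + 4 sin (ζ / 2) ≤ d + 2ζ`, so it is short enough. Its direction differs from
the old one by `y ≥ -ζ / 2`; hence `ζ ≤ 2 * η` makes its first arc nonnegative. -/
lemma UnitCSC.conn_add_two_pi_of_left_right {η d ζ l : ℝ} {p z : ℂ}
    (h : UnitCSC 1 (-1) η d ζ p z) (hη : η < Real.pi) (hζ : ζ < Real.pi) (hle : ζ ≤ 2 * η)
    (hl : η + d + ζ + 2 * Real.pi ≤ l) : Conn p z l := by
  have hpi := Real.pi_pos
  have hoff := h.offset_left_of_left_right
  have hz := h.heading
  obtain ⟨ha, ha', hd, hb, hb', hc⟩ := h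
  rcases hb.eq_or_lt with rfl | hb
  · have hc' : Cfg 1 (-1) η 0 (d / 2) (2 * Real.pi) p z := by
      refine ⟨by rw [hz, ← cis_sub_two_pi]; congr 1; ring, hc.2⟩
    exact hc'.conn_of_loop_last (by simp) (by simp) ha ha'.le le_rfl hpi
      (by rw [Real.sin_zero]; linarith) (by simp; linarith)
  · obtain ⟨w, hw⟩ : ∃ w : ℂ, w = d + 4 * Real.sin (ζ / 2) * cis (-(ζ / 2)) := ⟨_, rfl⟩
    have hs : 0 < Real.sin (ζ / 2) := Real.sin_pos_of_pos_of_lt_pi (by linarith) (by linarith)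
    have hcos : 0 < Real.cos (ζ / 2) :=
      Real.cos_pos_of_mem_Ioo ⟨by linarith, by linarith⟩
    have hre : w.re = d + 4 * (Real.sin (ζ / 2) * Real.cos (ζ / 2)) := by
      rw [hw]
      simp only [Complex.add_re, Complex.mul_im, cis_re, cis_im, Complex.ofReal_re,
        Complex.ofReal_im, Complex.mul_re, Complex.re_ofNat, Complex.im_ofNat, Real.cos_neg]
      ring
    have him : w.im = -(4 * (Real.sin (ζ / 2) * Real.sin (ζ / 2))) := by
      rw [hw]
      simp only [Complex.add_im, Complex.mul_im, cis_re, cis_im, Complex.ofReal_re,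
        Complex.ofReal_im, Complex.mul_re, Complex.re_ofNat, Complex.im_ofNat, Real.sin_neg]
      ring
    have hre0 : 0 < w.re := by
      rw [hre]
      have := mul_pos hs hcos
      linarith
    obtain ⟨y, hy⟩ : ∃ y, y = Complex.arg w := ⟨_, rfl⟩
    have hpolar : (‖w‖ : ℂ) * cis y = w := by
      rw [hy]; exact Complex.norm_mul_exp_arg_mul_I w
    have hy1 : |y| < Real.pi / 2 := by
      rw [hy]; exact Complex.abs_arg_lt_pi_div_two_iff.2 (.inl hre0)
    have hy0 : y < 0 := by
      rw [hy, Complex.arg_neg_iff, him]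
      have := mul_pos hs hs
      linarith
    have hn : 0 < ‖w‖ := norm_pos_iff.2 fun h0 => by simp [h0] at hre0
    have hy2 : -(ζ / 2) ≤ y := by
      by_contra hlt
      push Not at hlt
      have e1 : ‖w‖ * Real.sin (y + ζ / 2) = d * Real.sin (ζ / 2) := by
        have e2 : (‖w‖ : ℂ) * cis (y + ζ / 2) = d * cis (ζ / 2) + 4 * Real.sin (ζ / 2) := by
          rw [cis_add, ← mul_assoc, hpolar, hw]
          linear_combination 4 * Real.sin (ζ / 2) * cis_mul_cis_neg (ζ / 2)
        have := congrArg Complex.im e2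
        simpa only [Complex.add_im, Complex.mul_im, cis_re, cis_im, Complex.ofReal_re,
          Complex.ofReal_im, Complex.im_ofNat, Complex.re_ofNat, zero_mul, mul_zero, add_zero]
          using this
      have e3 : Real.sin (y + ζ / 2) < 0 :=
        Real.sin_neg_of_neg_of_neg_pi_lt (by linarith) (by linarith [(abs_lt.1 hy1).1])
      have e4 := mul_nonneg hd hs.le
      nlinarith
    have hL : UnitCSC 1 1 (y + η) ‖w‖ (2 * Real.pi - ζ - y) p z := by
      refine ⟨by linarith, by linarith, norm_nonneg _, by linarith, by linarith, ?_, ?_⟩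
      · rw [hz, ← cis_add_two_pi]; congr 1; ring
      · rw [← hw] at hoff
        rw [show 1 * (y + η) + 2 * 0 = y + η by ring, show 1 * (y + η) + 0 = y + η by ring,
          show 1 * (y + η) = y + η by ring, cis_add]
        push_cast
        linear_combination hoff - cis η * hpolar
    refine hL.climb_left_left.conn_of_pi_le (by linarith) ?_
    have hD : ‖w‖ ≤ d + 4 * Real.sin (ζ / 2) := by
      rw [hw]
      refine (norm_add_le _ _).trans_eq ?_
      rw [norm_mul, norm_cis, norm_mul, Complex.norm_real, Complex.norm_real,
        Real.norm_of_nonneg hd, Real.norm_of_nonneg hs.le]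
      simp
    have := Real.sin_le (x := ζ / 2) (by linarith)
    linarith

theorem UnitCSC.attained_left_right {η d ζ : ℝ} {p z : ℂ} (h : UnitCSC 1 (-1) η d ζ p z)
    (hη : η < Real.pi) (hζ : ζ < Real.pi) : Attained p z (η + d + ζ) := by
  intro l hl hc
  have hz := h.norm_eq_one
  have hr : UnitCSC 1 (-1) ζ d η (conj (conj p * z)) (conj z) := by simpa using h.reverse
  have hm : ζ + d + η = η + d + ζ := by ring
  have hLSL : ∀ η' d' ζ', UnitCSC 1 1 η' d' ζ' p z → η' + ζ' < Real.pi →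
      η' + d' + ζ' = η + d + ζ :=
    fun η' d' ζ' h' hT' => h.eq_of_left_right_of_left_left hη hζ h' hT'
  have hLSLr : ∀ η' d' ζ', UnitCSC 1 1 η' d' ζ' (conj (conj p * z)) (conj z) → η' + ζ' < Real.pi →
      η' + d' + ζ' = η + d + ζ := fun η' d' ζ' h' hT' => by
    rw [hr.eq_of_left_right_of_left_left hζ hη h' hT', hm]
  rcases hc with ⟨σ, hσ, hc⟩ | hc | ⟨σ₁, σ₃, η', d', ζ', h1, h3, hc, hne, hle⟩
  · rcases hσ with rfl | rfl
    · refine Conn.of_reverse hz ((hr.climb_left_right hζ hη).conn (by linarith)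
        fun a μ b hp => ?_)
      have hp' := hp.reverse
      simp only [map_mul, Complex.conj_conj, neg_neg] at hp'
      rw [show p * conj z * z = p by
        rw [mul_assoc, mul_comm (conj z), Complex.mul_conj, Complex.normSq_eq_norm_sq, hz]
        simp] at hp'
      linarith [hc b μ a hp']
    · exact (h.climb_left_right hη hζ).conn hl hc
  · rcases le_total ζ (2 * η) with hx | hx
    · exact h.conn_add_two_pi_of_left_right hη hζ hx hc
    · exact Conn.of_reverse hz
        (hr.conn_add_two_pi_of_left_right hζ hη (by linarith [h.1, h.2.2.2.1]) (by linarith))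
  · have hm' : ζ' + d' + η' = η' + d' + ζ' := by ring
    rcases h1 with rfl | rfl <;> rcases h3 with rfl | rfl
    · exact conn_of_left_left_of_ne hLSL hc hne hle
    · exact absurd (h.eq_of_left_right hc) hne
    · rcases le_total ζ (2 * η) with hx | hx
      · exact conn_of_right_left_of_ne hLSL (h.im_offset_of_left_right hη hx) hc hne hle
      · have hcr := hc.reverse
        rw [neg_neg] at hcr
        exact Conn.of_reverse hz (conn_of_right_left_of_ne hLSLr
          (hr.im_offset_of_left_right hζ (by linarith [h.1, h.2.2.2.1])) hcr
          (by rwa [hm']) (by linarith))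
    · have hcr := hc.reverse
      rw [neg_neg] at hcr
      exact Conn.of_reverse hz (conn_of_left_left_of_ne hLSLr hcr (by rwa [hm']) (by linarith))

/-! ### Finiteness of the CSC lengths and the combined statement -/

/-- The distance of the left centres fixes `d`, and the heading fixes `η + ζ` up to one extra turn.
-/
lemma finite_lengths_left_left {p z : ℂ} (hz : ‖z‖ = 1) :
    {l : ℝ | ∃ η d ζ, UnitCSC 1 1 η d ζ p z ∧ l = η + d + ζ}.Finite := by
  obtain ⟨θ, h0, hθ, hθz⟩ := exists_cis_eq hz
  refine (Set.toFinite {‖p + I * z - I‖ + θ, ‖p + I * z - I‖ + θ + 2 * Real.pi}).subset ?_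
  rintro l ⟨η, d, ζ, h, rfl⟩
  have hd := congrArg norm h.offset_left_of_left_left
  rw [norm_mul, norm_cis, Complex.norm_real, Real.norm_of_nonneg h.2.2.1, one_mul] at hd
  have e := h.heading
  rw [← hθz, one_mul, one_mul] at e
  rw [hd]
  rcases lt_or_ge (η + ζ) (2 * Real.pi) with hT | hT
  · left
    rw [eq_of_cis_eq e (abs_lt.2 ⟨by linarith, by linarith [h.1, h.2.2.2.1]⟩)]
    ring
  · right
    rw [← cis_sub_two_pi (η + ζ)] at e
    rw [mem_singleton_iff, eq_of_cis_eq e (abs_lt.2 ⟨by linarith [h.2.1, h.2.2.2.2.1], by linarith⟩)]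
    ring

lemma finite_lengths_left_right (p z : ℂ) :
    {l : ℝ | ∃ η d ζ, UnitCSC 1 (-1) η d ζ p z ∧ l = η + d + ζ}.Finite := by
  refine Set.Subsingleton.finite ?_
  rintro _ ⟨η, d, ζ, h, rfl⟩ _ ⟨η', d', ζ', h', rfl⟩
  exact h'.eq_of_left_right h

lemma finite_lengths {p z : ℂ} (hz : ‖z‖ = 1) {σ₁ σ₃ : ℝ} (h₁ : σ₁ = 1 ∨ σ₁ = -1)
    (h₃ : σ₃ = 1 ∨ σ₃ = -1) :
    {l : ℝ | ∃ η d ζ, UnitCSC σ₁ σ₃ η d ζ p z ∧ l = η + d + ζ}.Finite := by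
  have key : ∀ σ : ℝ, σ = 1 ∨ σ = -1 → ∀ {p z : ℂ}, ‖z‖ = 1 →
      {l : ℝ | ∃ η d ζ, UnitCSC 1 σ η d ζ p z ∧ l = η + d + ζ}.Finite := by
    rintro σ (rfl | rfl) p z hz
    · exact finite_lengths_left_left hz
    · exact finite_lengths_left_right p z
  rcases h₁ with rfl | rfl
  · exact key σ₃ h₃ hz
  · refine (key (-σ₃) (by rcases h₃ with rfl | rfl <;> simp) (p := conj p) (z := conj z)
      (by simpa using hz)).subset ?_
    rintro l ⟨η, d, ζ, h, rfl⟩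
    exact ⟨η, d, ζ, by simpa using h.mirror, rfl⟩

lemma exists_unitCCC {p z : ℂ} (hz : ‖z‖ = 1) {σ : ℝ} (hσ : σ = 1 ∨ σ = -1)
    (hw : ‖p + σ * (I * z - I)‖ < 4) :
    ∃ a μ b, UnitCCC σ a μ b p z ∧ ∀ l, a + μ + b ≤ l → Conn p z l := by
  rcases hσ with rfl | rfl
  · obtain ⟨a, μ, b, h, h'⟩ := exists_unitCCC_right (p := conj p) (z := conj z) (by simpa using hz)
      (by
        rw [← Complex.norm_conj] at hw
        convert hw using 2
        simp
        ring)
    exact ⟨a, μ, b, by simpa using h.mirror, fun l hl => (h' l hl).of_mirror⟩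
  · refine exists_unitCCC_right hz ?_
    convert hw using 2
    push_cast
    ring

theorem UnitCSC.attained {σ₁ σ₃ η d ζ : ℝ} {p z : ℂ} (h : UnitCSC σ₁ σ₃ η d ζ p z)
    (h₁ : σ₁ = 1 ∨ σ₁ = -1) (h₃ : σ₃ = 1 ∨ σ₃ = -1) (hη : η < Real.pi) (hζ : ζ < Real.pi) :
    Attained p z (η + d + ζ) := by
  rcases h₁ with rfl | rfl <;> rcases h₃ with rfl | rfl
  · exact h.attained_left_left hη hζ
  · exact h.attained_left_right hη hζ
  · exact Attained.of_mirror (UnitCSC.attained_left_right (by simpa using h.mirror) hη hζ)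
  · exact Attained.of_mirror (UnitCSC.attained_left_left (by simpa using h.mirror) hη hζ)

/-! ### From the unit scale to trajectories -/

lemma Piece.arc_move {rmin r : ℝ} (hr : 0 < rmin) (h1 : 1 ≤ |r|) (P : OrientedPoint) (x : ℝ) :
    (Piece.arc (rmin * r)).move P (rmin * (r * x)) =
      ⟨P.pos + rmin * (cis P.heading * (-I * r * (cis x - 1))), P.heading + x⟩ := by
  have hr0 : r ≠ 0 := by
    rintro rfl
    norm_num at h1
  have e : rmin * (r * x) / (rmin * r) = x := by field_simp
  simp only [Piece.move, e, centre, dir_eq_cis, cis_add]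
  congr 1
  push_cast
  ring

lemma Piece.arc_allowed {rmin r x : ℝ} (hr : 0 < rmin) (h1 : 1 ≤ |r|) (h2 : 0 ≤ r * x)
    (h3 : |x| ≤ 2 * Real.pi) : (Piece.arc (rmin * r)).Allowed rmin (rmin * (r * x)) := by
  refine ⟨?_, by positivity, ?_⟩
  · rw [abs_mul, abs_of_pos hr]; nlinarith
  · rw [abs_mul, abs_of_pos hr, ← abs_of_nonneg h2, abs_mul]
    have : |r| * |x| ≤ |r| * (2 * Real.pi) := mul_le_mul_of_nonneg_left h3 (abs_nonneg r)
    nlinarith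

lemma Mid.exists_piece {rmin m ℓ : ℝ} {q : ℂ} (hr : 0 < rmin) (h : Mid m q ℓ) :
    ∃ p : Piece, p.Allowed rmin (rmin * ℓ) ∧ ∀ P, p.move P (rmin * ℓ) =
      ⟨P.pos + rmin * (cis P.heading * q), P.heading + m⟩ := by
  rcases h with ⟨rfl, h, rfl⟩ | ⟨r, h1, h2, h3, rfl, rfl⟩
  · refine ⟨.line, ?_, fun P => ?_⟩
    · change 0 ≤ rmin * ℓ
      positivity
    · simp only [Piece.move, dir_eq_cis, add_zero]
      congr 1
      push_cast
      ring
  · exact ⟨.arc (rmin * r), Piece.arc_allowed hr h1 h2 h3, fun P => Piece.arc_move hr h1 P m⟩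

/-- The position of `B` in the frame of `A`, at the scale `rmin`. -/
noncomputable def relPos (rmin : ℝ) (A B : OrientedPoint) : ℂ :=
  (B.pos - A.pos) * cis (-A.heading) / rmin

/-- The direction of `B` in the frame of `A`. -/
noncomputable def relDir (A B : OrientedPoint) : ℂ := cis (B.heading - A.heading)

lemma norm_relDir (A B : OrientedPoint) : ‖relDir A B‖ = 1 := norm_cis _

lemma relPos_eq_iff {rmin : ℝ} (hr : 0 < rmin) (A B : OrientedPoint) (q : ℂ) :
    relPos rmin A B = q ↔ B.pos = A.pos + rmin * (cis A.heading * q) := by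
  have hr' : (rmin : ℂ) ≠ 0 := by exact_mod_cast hr.ne'
  have e := cis_mul_cis_neg A.heading
  unfold relPos
  rw [div_eq_iff hr']
  constructor
  · intro h
    linear_combination (-(B.pos - A.pos)) * e + cis A.heading * h
  · intro h
    linear_combination cis (-A.heading) * h + q * rmin * e

lemma relDir_eq_iff (A B : OrientedPoint) (t : ℝ) :
    relDir A B = cis t ↔ dir B.heading = dir (A.heading + t) := by
  rw [dir_eq_cis, dir_eq_cis, cis_add, relDir, sub_eq_add_neg, cis_add]
  have e := cis_mul_cis_neg A.heading
  constructor
  · intro h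
    linear_combination cis A.heading * h - cis B.heading * e
  · intro h
    linear_combination cis (-A.heading) * h + cis t * e

lemma Conn.exists_trajectory {rmin l : ℝ} (hr : 0 < rmin) {A B : OrientedPoint}
    (h : Conn (relPos rmin A B) (relDir A B) l) :
    ∃ Λ : ℝ → ℂ, IsTrajectory rmin A B (rmin * l) Λ ∧ IsCircleCircleCircle rmin A (rmin * l) Λ := by
  obtain ⟨r₁, x₁, r₃, x₃, m, q, ℓ, h1, h2, h3, h4, h5, h6, h7, hz, hp, rfl⟩ := h
  obtain ⟨p₂, ha₂, hm₂⟩ := h7.exists_piece hr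
  have ha₁ := Piece.arc_allowed hr h1 h2 h3
  have ha₃ := Piece.arc_allowed hr h4 h5 h6
  have e : rmin * (r₁ * x₁ + ℓ + r₃ * x₃) = rmin * (r₁ * x₁) + rmin * ℓ + rmin * (r₃ * x₃) := by
    ring
  rw [e]
  refine ⟨_, isTrajectory_concatCurve hr ha₁ ha₂ ha₃ ?_, rmin * r₁, rmin * r₃, p₂, rmin * (r₁ * x₁),
    rmin * ℓ, rmin * (r₃ * x₃), ha₁, ha₂, ha₃, rfl, fun t _ => rfl⟩
  rw [Piece.arc_move hr h1, hm₂, Piece.arc_move hr h4]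
  constructor
  · rw [(relPos_eq_iff hr A B _).1 hp, hz]
    simp only [cis_add]
    ring
  · rw [(relDir_eq_iff A B _).1 hz]
    congr 1
    ring

lemma Turn.radius_eq_mul (rmin : ℝ) (X : Turn) : X.radius rmin = rmin * X.radius 1 := by
  cases X <;> simp [Turn.radius]

lemma Turn.radius_one (X : Turn) : X.radius 1 = 1 ∨ X.radius 1 = -1 := by
  cases X <;> simp [Turn.radius]

lemma Turn.radius_opp (rmin : ℝ) (X : Turn) : X.opp.radius rmin = -X.radius rmin := by
  cases X <;> simp [Turn.radius, Turn.opp]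

lemma Turn.abs_radius_one (X : Turn) : |X.radius 1| = 1 := by
  cases X <;> simp [Turn.radius]

lemma Turn.arc_move {rmin : ℝ} (hr : 0 < rmin) (X : Turn) (P : OrientedPoint) (x : ℝ) :
    (Piece.arc (X.radius rmin)).move P (rmin * x) =
      ⟨P.pos + rmin * (cis P.heading * (-I * X.radius 1 * (cis (X.radius 1 * x) - 1))),
        P.heading + X.radius 1 * x⟩ := by
  have h := Piece.arc_move hr X.abs_radius_one.ge P (X.radius 1 * x)
  have e : X.radius 1 * (X.radius 1 * x) = x := by cases X <;> simp [Turn.radius]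
  rwa [e, ← Turn.radius_eq_mul] at h

lemma IsCSC.unitCSC {rmin : ℝ} (hr : 0 < rmin) {A B : OrientedPoint} {X Y : Turn} {η d ζ : ℝ}
    (h : IsCSC rmin A B X Y η d ζ) :
    UnitCSC (X.radius 1) (Y.radius 1) η (d / rmin) ζ (relPos rmin A B) (relDir A B) := by
  obtain ⟨hη, hd, hζ, hB⟩ := h
  have hr' : (rmin : ℂ) ≠ 0 := by exact_mod_cast hr.ne'
  rw [Turn.arc_move hr X, Turn.arc_move hr Y, Piece.move] at hB
  have hz : relDir A B = cis (X.radius 1 * η + 2 * 0 + Y.radius 1 * ζ) := by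
    rw [relDir_eq_iff, hB.2]
    congr 1
    ring
  refine ⟨hη.1, hη.2, by positivity, hζ.1, hζ.2, hz, ?_⟩
  rw [relPos_eq_iff hr, hB.1, hz]
  simp only [dir_eq_cis, mul_zero, add_zero, cis_add]
  push_cast
  field_simp
  ring

lemma UnitCCC.isCCC {rmin : ℝ} (hr : 0 < rmin) {A B : OrientedPoint} {X : Turn} {a μ b : ℝ}
    (h : UnitCCC (X.radius 1) a μ b (relPos rmin A B) (relDir A B)) :
    IsCCC rmin A B X a μ b := by
  obtain ⟨h1, h2, h3, h4, h5, h6, hz, hp⟩ := h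
  refine ⟨⟨h1, h2⟩, ⟨h3, h4⟩, ⟨h5, h6⟩, ?_⟩
  rw [Turn.arc_move hr X, Turn.arc_move hr X.opp, Turn.arc_move hr X, Turn.radius_opp]
  constructor
  · rw [(relPos_eq_iff hr A B _).1 hp, hz]
    rw [show X.radius 1 * (a - μ + b) = X.radius 1 * a + -X.radius 1 * μ + X.radius 1 * b by ring,
      show X.radius 1 * (a - μ) = X.radius 1 * a + -X.radius 1 * μ by ring]
    simp only [cis_add]
    push_cast
    ring
  · rw [(relDir_eq_iff A B _).1 hz]
    congr 1
    ring

lemma UnitCCC.mem_lengthsCCC {rmin : ℝ} (hr : 0 < rmin) {A B : OrientedPoint} {X : Turn}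
    {a μ b : ℝ} (h : UnitCCC (X.radius 1) a μ b (relPos rmin A B) (relDir A B)) :
    rmin * (a + μ + b) ∈ lengthsCCC rmin A B X :=
  ⟨a, μ, b, h.isCCC hr, rfl⟩

lemma bddBelow_lengthsCCC {rmin : ℝ} (hr : 0 < rmin) (A B : OrientedPoint) (X : Turn) :
    BddBelow (lengthsCCC rmin A B X) := by
  refine ⟨0, ?_⟩
  rintro _ ⟨η, μ, ζ, ⟨h1, h2, h3, -⟩, rfl⟩
  have := h1.1
  have := h2.1
  have := h3.1
  positivity

lemma bddAbove_lengthsCCC {rmin : ℝ} (hr : 0 < rmin) (A B : OrientedPoint) (X : Turn) :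
    BddAbove (lengthsCCC rmin A B X) := by
  refine ⟨rmin * (6 * Real.pi), ?_⟩
  rintro _ ⟨η, μ, ζ, ⟨h1, h2, h3, -⟩, rfl⟩
  exact mul_le_mul_of_nonneg_left (by linarith [h1.2, h2.2, h3.2]) hr.le

lemma dist_centre {rmin : ℝ} (hr : 0 < rmin) (A B : OrientedPoint) (X : Turn) :
    dist (centre A (X.radius rmin)) (centre B (X.radius rmin)) =
      rmin * ‖relPos rmin A B + X.radius 1 * (I * relDir A B - I)‖ := by
  have e : centre B (X.radius rmin) - centre A (X.radius rmin) = rmin * (cis A.heading *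
      (relPos rmin A B + X.radius 1 * (I * relDir A B - I))) := by
    have h1 := (relPos_eq_iff hr A B _).1 rfl
    have h2 : cis B.heading = cis A.heading * relDir A B := by
      rw [relDir, ← cis_add]; congr 1; ring
    rw [centre, centre, dir_eq_cis, dir_eq_cis, h1, h2, Turn.radius_eq_mul rmin X]
    push_cast
    ring
  rw [dist_comm, dist_eq_norm, e, norm_mul, norm_mul, norm_cis, one_mul, Complex.norm_real,
    Real.norm_of_nonneg hr.le]

instance : Finite Turn :=
  Finite.of_injective (fun X : Turn => X.radius 1 = 1) fun X Y h => by
    cases X <;> cases Y <;> first | rfl | (norm_num [Turn.radius] at h)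

lemma finite_lengthsCSC {rmin : ℝ} (hr : 0 < rmin) (A B : OrientedPoint) (X Y : Turn) :
    (lengthsCSC rmin A B X Y).Finite := by
  refine ((finite_lengths (p := relPos rmin A B) (norm_relDir A B) X.radius_one
    Y.radius_one).image (fun l => rmin * l)).subset ?_
  rintro l ⟨η, d, ζ, h, rfl⟩
  refine ⟨_, ⟨η, d / rmin, ζ, h.unitCSC hr, rfl⟩, ?_⟩
  field_simp

lemma minLength_le {rmin : ℝ} {A B : OrientedPoint} {s : ℝ} (h : s ∈ reachableLengths rmin A B) :
    minLength rmin A B ≤ s :=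
  csInf_le ⟨0, fun _ ⟨_, hs⟩ => hs.1⟩ h

end Dubins

/-! ### The theorem at scale `rmin` -/

theorem mainTheorem1 (rmin : ℝ) (hr : 0 < rmin) (A B : Dubins.OrientedPoint)
    (hAB : (A, B) ∈ Dubins.Oc rmin) (lo : ℝ)
    (hlo : lo ∈ Set.Icc (Dubins.minLength rmin A B) (Dubins.l₁ rmin A B) ∪
      Set.Ici (Dubins.l₂ rmin A B)) :
    ∃ Λ : ℝ → ℂ, Dubins.IsTrajectory rmin A B lo Λ ∧
      Dubins.IsCircleCircleCircle rmin A lo Λ := by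
  open Dubins in
  obtain ⟨⟨η, d, ζ, hS⟩, hO⟩ := hAB
  have hO' : (A, B) ∉ O₁ rmin ∧ (A, B) ∉ O₂ rmin ∧ (A, B) ∉ O₄ rmin ∧ (A, B) ∉ O₅ rmin :=
    ⟨fun h => hO (by simp [O, h]), fun h => hO (by simp [O, h]), fun h => hO (by simp [O, h]),
      fun h => hO (by simp [O, h])⟩
  have hη : η < Real.pi := not_le.1 fun h => hO'.1 ⟨η, d, ζ, hS, h⟩
  have hζ : ζ < Real.pi := not_le.1 fun h => hO'.2.1 ⟨η, d, ζ, hS, h⟩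
  have hD : ∀ X : Turn,
      ‖relPos rmin A B + X.radius 1 * (Complex.I * relDir A B - Complex.I)‖ < 4 := by
    intro X
    refine lt_of_mul_lt_mul_left (a := rmin) ?_ hr.le
    rw [← dist_centre hr, mul_comm rmin 4]
    cases X
    · exact not_le.1 fun h => hO'.2.2.2 ⟨η, d, ζ, hS, h⟩
    · exact not_le.1 fun h => hO'.2.2.1 ⟨η, d, ζ, hS, h⟩
  obtain ⟨X, Y, hC, hmin⟩ := hS
  have hatt := (hC.unitCSC hr).attained X.radius_one Y.radius_one hη hζ
  have hm : rmin * (η + d / rmin + ζ) = minLength rmin A B := by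
    rw [← hmin]
    field_simp
  have hlo' : rmin * (lo / rmin) = lo := mul_div_cancel₀ lo hr.ne'
  have hscale : ∀ x, rmin * x ≤ lo → x ≤ lo / rmin := fun x hx => (le_div_iff₀' hr).2 hx
  have hdone : Conn (relPos rmin A B) (relDir A B) (lo / rmin) → ∃ Λ : ℝ → ℂ,
      IsTrajectory rmin A B lo Λ ∧ IsCircleCircleCircle rmin A lo Λ := fun h => by
    simpa only [hlo'] using h.exists_trajectory hr
  apply hdone
  rcases hlo with ⟨h1, h2⟩ | h
  · refine hatt _ (hscale _ (hm.trans_le h1)) (.inl ?_)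
    have hex : ∃ Z : Turn, lo ≤ shortCCC rmin A B Z := by
      rcases le_max_iff.1 h2 with h | h
      · exact ⟨_, h⟩
      · exact ⟨_, h⟩
    obtain ⟨Z, hZ⟩ := hex
    refine ⟨Z.radius 1, Z.radius_one, fun a μ b hp => (div_le_iff₀' hr).2 (hZ.trans ?_)⟩
    exact csInf_le (bddBelow_lengthsCCC hr A B Z) (hp.mem_lengthsCCC hr)
  -- The constructed CCC path need not be the longest: the supremum bounds its length, and all
  -- greater lengths are attained.
  · have hlong : ∀ Z : Turn, longCCC rmin A B Z ≤ lo →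
        Conn (relPos rmin A B) (relDir A B) (lo / rmin) := by
      intro Z hZ
      obtain ⟨a, μ, b, hp, hc⟩ := exists_unitCCC (norm_relDir A B) Z.radius_one (hD Z)
      exact hc _ (hscale _
        ((le_csSup (bddAbove_lengthsCCC hr A B Z) (hp.mem_lengthsCCC hr)).trans hZ))
    -- The candidate set is finite, so the infimum is one of the candidates.
    have hmem : l₂ rmin A B ∈ _ := Set.Nonempty.csInf_mem ⟨_, .inl (.inl rfl)⟩
      ((Set.toFinite _).union ((Set.finite_iUnion fun X => Set.finite_iUnion fun Y =>
        finite_lengthsCSC hr A B X Y).subset Set.sdiff_subset))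
    rw [Set.mem_Ici] at h
    rcases hmem with (h1 | h1 | h1) | ⟨h1, h2⟩
    · rw [h1, ← hm] at h
      have hpi := Real.pi_pos
      have h3 := hscale (η + d / rmin + ζ + 2 * Real.pi) (by linarith)
      exact hatt _ (by linarith) (.inr (.inl h3))
    · exact hlong _ (h1 ▸ h)
    · exact hlong _ (h1 ▸ h)
    · simp only [Set.mem_iUnion] at h1
      obtain ⟨X', Y', η', d', ζ', hC', hl⟩ := h1
      have hU := hC'.unitCSC hr
      have e : rmin * (η' + d' / rmin + ζ') = l₂ rmin A B := by
        rw [hl]; field_simp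
      obtain ⟨Λ, hΛ, -⟩ := (hU.conn X'.abs_radius_one Y'.abs_radius_one).exists_trajectory hr
      -- The other CSC path is itself a trajectory, hence not shorter than the minimum.
      have h3 : minLength rmin A B ≤ l₂ rmin A B := by
        rw [← e]
        exact minLength_le ⟨Λ, hΛ⟩
      refine hatt _ (hscale _ (by linarith)) (.inr (.inr ⟨_, _, η', d' / rmin, ζ', X'.radius_one,
        Y'.radius_one, hU, fun h4 => h2 ?_, hscale _ (by linarith)⟩))
      rw [Set.mem_singleton_iff, ← e, ← hm, h4]
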